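/- **Corollary (asymptotically MSE-optimal $m$).** Let $X_1,X_2,\dots$ be i.i.d. nonnegative random variables with a continuous distribution function $F$ whose first two derivatives $f=F'$ and $f'=F''$ exist and are continuous and bounded on $[0,\infty)$ (one-sided derivatives at $0$). For $n\ge 1$ and real $m>0$, let $F_n(t)=\frac1n\sum_{i=1}^n\mathbb I(X_i\le t)$ and let $$\hat F^S_{m,n}(x)=\sum_{k=0}^\infty F_n\!\left(\tfrac km\right)e^{-mx}\frac{(mx)^k}{k!},\qquad \mathrm{MSE}\big[\hat F^S_{m,n}(x)\big]=\mathbb E\Big[\big(\hat F^S_{m,n}(x)-F(x)\big)^2\Big]$$ be the Szasz estimator and its mean-squared error. Put $\sigma^2(x)=F(x)(1-F(x))$, $b^S(x)=\frac{x f'(x)}2$ and $V^S(x)=f(x)\left[\frac x\pi\right]^{1/2}$. Let $x\in(0,\infty)$ with $f(x)\ne0$ and $f'(x)\ne 0$. Then the asymptotically optimal choice of $m$ for estimating $F(x)$ with respect to MSE is $$m_{opt}=m_{opt}(n)=n^{2/3}\left[\frac{4(b^S(x))^2}{V^S(x)}\right]^{2/3},$$ in the following sense: 1. for every $n\ge1$,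 $m_{opt}(n)$ is positive and is the unique minimizer over $m\in(0,\infty)$ of the leading part $n^{-1}\sigma^2(x)-m^{-1/2}n^{-1}V^S(x)+m^{-2}(b^S(x))^2$ of the MSE; 2. $m_{opt}(n)\to\infty$ and, for every real sequence $m_n\to\infty$ and every $\varepsilon>0$, one has $\mathrm{MSE}[\hat F^S_{m_{opt}(n),n}(x)]\le \mathrm{MSE}[\hat F^S_{m_n,n}(x)]+\varepsilon n^{-4/3}$ for all large $n$; moreover $\mathrm{MSE}[\hat F^S_{m_n,n}(x)]-\mathrm{MSE}[\hat F^S_{m_{opt}(n),n}(x)]=o(n^{-4/3})$ if and only if $m_n/m_{opt}(n)\to1$. The associated MSE is, as $n\to\infty$, $$\mathrm{MSE}\big[\hat F^S_{m_{opt},n}(x)\big]=n^{-1}\sigma^2(x)-\frac34 n^{-4/3}\left[\frac{(V^S(x))^4}{4(b^S(x))^2}\right]^{1/3}+o_x(n^{-4/3}),$$ where the rate of convergence of the remainder may depend on $x$. -/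

import Mathlib

open MeasureTheory ProbabilityTheory Filter Asymptotics

namespace Szasz

noncomputable section

/-- The empirical distribution function `F_n(t) = (1/n) ∑_{i=1}^n 𝟙(X_i ≤ t)` of the first `n`
members of the sequence `X` (indexed from `0`). -/
def edf {Ω : Type*} (X : ℕ → Ω → ℝ) (n : ℕ) (ω : Ω) (t : ℝ) : ℝ :=
  (1 / (n : ℝ)) * ∑ i ∈ Finset.range n, Set.indicator (Set.Iic t) (fun _ => (1 : ℝ)) (X i ω)

/-- The Poisson weights `V_{k,m}(x) = e^{-mx} (mx)^k / k!`, with a real parameter `m`. -/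
def weight (k : ℕ) (m x : ℝ) : ℝ :=
  Real.exp (-(m * x)) * (m * x) ^ k / (k.factorial : ℝ)

/-- The Szasz estimator `∑_{k ≥ 0} F_n(k/m) V_{k,m}(x)`. The series always converges absolutely,
since `0 ≤ F_n ≤ 1`. -/
def estimator {Ω : Type*} (X : ℕ → Ω → ℝ) (m : ℝ) (n : ℕ) (ω : Ω) (x : ℝ) : ℝ :=
  ∑' k : ℕ, edf X n ω ((k : ℝ) / m) * weight k m x

/-- The mean-squared error `E[(F̂_{m,n}(x) - F(x))²]`. For measurable `X`, `m > 0` and `x ≥ 0` the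
integrand is bounded and measurable, hence integrable. -/
def mse {Ω : Type*} [MeasurableSpace Ω] (P : Measure Ω) (X : ℕ → Ω → ℝ) (F : ℝ → ℝ) (x : ℝ)
    (n : ℕ) (m : ℝ) : ℝ :=
  ∫ ω, (estimator X m n ω x - F x) ^ 2 ∂P

/-- `σ²(x) = F(x) (1 - F(x))`. -/
def sigmaSq (F : ℝ → ℝ) (x : ℝ) : ℝ := F x * (1 - F x)

/-- `b(x) = x f'(x) / 2`. -/
def b (f' : ℝ → ℝ) (x : ℝ) : ℝ := x * f' x / 2

/-- `V(x) = f(x) (x/π)^{1/2}`. -/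
def V (f : ℝ → ℝ) (x : ℝ) : ℝ := f x * (x / Real.pi) ^ ((1 : ℝ) / 2)

/-- The leading part `n⁻¹ σ²(x) - m^{-1/2} n⁻¹ V(x) + m⁻² b(x)²` of the mean-squared error. -/
def leadingMse (F f f' : ℝ → ℝ) (x : ℝ) (n : ℕ) (m : ℝ) : ℝ :=
  (n : ℝ)⁻¹ * sigmaSq F x - m ^ (-(1 : ℝ) / 2) * (n : ℝ)⁻¹ * V f x + m ^ (-2 : ℝ) * b f' x ^ 2

/-- `m_opt(n) = n^{2/3} [4 b(x)² / V(x)]^{2/3}`. -/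
def mOpt (f f' : ℝ → ℝ) (x : ℝ) (n : ℕ) : ℝ :=
  (n : ℝ) ^ ((2 : ℝ) / 3) * (4 * b f' x ^ 2 / V f x) ^ ((2 : ℝ) / 3)

/-- Asymptotic optimality, up to errors of smaller order than `r n`, of the sequence `m₀` for the
risk `R n m` among all sequences of parameters tending to infinity: no such sequence does better,
and the sequences that do equally well are exactly those asymptotically equivalent to `m₀`. -/
def IsAsymptoticallyOptimal (R : ℕ → ℝ → ℝ) (r : ℕ → ℝ) (m₀ : ℕ → ℝ) : Prop :=
  Tendsto m₀ atTop atTop ∧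
    ∀ m : ℕ → ℝ, Tendsto m atTop atTop →
      (∀ ε > 0, ∀ᶠ n in atTop, R n (m₀ n) ≤ R n (m n) + ε * r n) ∧
      ((fun n => R n (m n) - R n (m₀ n)) =o[atTop] r ↔ m ~[atTop] m₀)

end

end Szasz

/-! Let `N`, `N'` be independent Poisson variables of rate `m x`. The estimator is the average of
the i.i.d. variables `T(X_i)`, where `T(t) = P(t ≤ N/m)`. Hence the MSE is `(E T² - (E T)²)/n + (E T
- F x)²`, and Fubini gives `E T = E F(N/m)` and `E T² = E F(min(N,N')/m)` (`mse_eq`).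

Bias: a second-order Taylor expansion with `Var(N/m) = x/m` gives `b/m + o(1/m)`. Variance:
`min(N,N') = (N+N')/2 - |N-N'|/2`, and `(N-N')/√m` tends in law to a centred Gaussian of variance
`2x` with bounded second moments, so `E|N-N'|/√m → 2√(x/π)`; this produces the term `-V/√m`.

With `q³ = 4b²/V` and `r = √(m_opt/m)`, it follows that `n^{4/3}(MSE - σ²/n) = (b²/q⁴)(r⁴ e₁ - 4 r
e₂)`, where `e₁, e₂ → 1` as `m → ∞`. On `r ≥ 0` the quartic `r⁴ - 4r` has its minimum `-3` only at
`r = 1`, since `r⁴ - 4r + 3 = (r-1)²((r+1)² + 2)`. This last quartic also controls `r⁴ + 4r`, so the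
perturbations are harmless even for unbounded `r`; no growth condition on `m_n` is needed
(`tendsto_perturbed_quartic_iff`, `eventually_quartic_le`). -/

namespace Szasz

open scoped NNReal Topology

/-! ### Moments of the Poisson distribution -/

section PoissonMoments

variable (r : ℝ≥0)

/-- Since `k / k! = 1 / (k-1)!`, the term `k = 0` drops out and the index shifts by one. Both
integrability and the Stein-Chen identity are read off from this sum. -/
theorem hasSum_poisson_shift {g : ℕ → ℝ} (hg : Integrable (fun k => g (k + 1)) (poissonMeasure r)) :
    HasSum (fun k : ℕ => (Real.exp (-r) * r ^ k / (k.factorial : ℝ)) • ((k : ℝ) * g k))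
      (r * ∫ k, g (k + 1) ∂poissonMeasure r) := by
  rw [← hasSum_nat_add_iff' 1]
  simp only [Finset.range_one, Finset.sum_singleton, Nat.cast_zero, zero_mul, smul_zero, sub_zero]
  convert! (hasSum_integral_poissonMeasure hg).mul_left (r : ℝ) using 2 with k
  have h1 : (k.factorial : ℝ) ≠ 0 := by positivity
  have h2 : ((k : ℝ) + 1) ≠ 0 := by positivity
  simp only [smul_eq_mul, Nat.factorial_succ, Nat.cast_mul, Nat.cast_add, Nat.cast_one, pow_succ]
  field_simp

theorem integrable_poisson_natCast_mul {g : ℕ → ℝ}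
    (hg : Integrable (fun k => g (k + 1)) (poissonMeasure r)) :
    Integrable (fun k : ℕ => (k : ℝ) * g k) (poissonMeasure r) := by
  rw [integrable_poissonMeasure_iff]
  refine (hasSum_poisson_shift r (g := fun k => |g k|) hg.abs).summable.congr fun k => ?_
  simp only [smul_eq_mul, Real.norm_eq_abs, abs_mul, Nat.abs_cast]

/-- The Stein-Chen identity `E[N g(N)] = r E[g(N + 1)]` for the Poisson distribution. -/
theorem integral_poisson_natCast_mul {g : ℕ → ℝ}
    (hg : Integrable (fun k => g (k + 1)) (poissonMeasure r)) :
    ∫ k : ℕ, (k : ℝ) * g k ∂poissonMeasure r = r * ∫ k, g (k + 1) ∂poissonMeasure r := by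
  rw [integral_poissonMeasure]
  exact (hasSum_poisson_shift r hg).tsum_eq

/-- Induction through `(k+c)^(j+1) = k (k+c)^j + c (k+c)^j`. The shift `c` must vary because
Stein-Chen replaces `k` by `k+1`. -/
theorem integrable_poisson_add_pow (j : ℕ) (c : ℝ) :
    Integrable (fun k : ℕ => ((k : ℝ) + c) ^ j) (poissonMeasure r) := by
  induction j generalizing c with
  | zero => simp
  | succ j ih =>
    have h := integrable_poisson_natCast_mul r (g := fun k => ((k : ℝ) + c) ^ j)
      (by simpa [add_assoc] using ih (1 + c))
    refine (h.add ((ih c).const_mul c)).congr (Eventually.of_forall fun k => ?_)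
    simp only [Pi.add_apply]
    ring

theorem integrable_poisson_pow (j : ℕ) :
    Integrable (fun k : ℕ => (k : ℝ) ^ j) (poissonMeasure r) := by
  simpa using integrable_poisson_add_pow r j 0

theorem integrable_poisson_natCast : Integrable (fun k : ℕ => (k : ℝ)) (poissonMeasure r) := by
  simpa using integrable_poisson_pow r 1

theorem integral_poisson_natCast : ∫ k : ℕ, (k : ℝ) ∂poissonMeasure r = r := by
  simpa using integral_poisson_natCast_mul r (g := fun _ => 1) (by simp)

/-- The integral of a polynomial of degree at most four, in terms of the moments. -/
theorem integral_poisson_quartic (a b c d e : ℝ) :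
    ∫ k : ℕ, (a + b * k + c * (k : ℝ) ^ 2 + d * (k : ℝ) ^ 3 + e * (k : ℝ) ^ 4) ∂poissonMeasure r =
      a + b * r + c * ∫ k : ℕ, (k : ℝ) ^ 2 ∂poissonMeasure r +
        d * ∫ k : ℕ, (k : ℝ) ^ 3 ∂poissonMeasure r +
        e * ∫ k : ℕ, (k : ℝ) ^ 4 ∂poissonMeasure r := by
  have i0 : Integrable (fun _ : ℕ => a) (poissonMeasure r) := integrable_const a
  have i1 := (integrable_poisson_natCast r).const_mul b
  have i2 := (integrable_poisson_pow r 2).const_mul c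
  have i3 := (integrable_poisson_pow r 3).const_mul d
  have i4 := (integrable_poisson_pow r 4).const_mul e
  have j1 : Integrable (fun k : ℕ => a + b * (k : ℝ)) (poissonMeasure r) := i0.add i1
  have j2 : Integrable (fun k : ℕ => a + b * (k : ℝ) + c * (k : ℝ) ^ 2) (poissonMeasure r) :=
    j1.add i2
  have j3 : Integrable (fun k : ℕ => a + b * (k : ℝ) + c * (k : ℝ) ^ 2 + d * (k : ℝ) ^ 3)
    (poissonMeasure r) := j2.add i3
  rw [integral_add j3 i4, integral_add j2 i3, integral_add j1 i2, integral_add i0 i1, integral_const_mul, integral_const_mul,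
    integral_const_mul, integral_const_mul, integral_poisson_natCast]
  simp

theorem integral_poisson_sq : ∫ k : ℕ, (k : ℝ) ^ 2 ∂poissonMeasure r = r ^ 2 + r := by
  have h := integral_poisson_natCast_mul r (g := fun k => (k : ℝ))
    (by simpa using integrable_poisson_add_pow r 1 1)
  have h2 := integral_poisson_quartic r 1 1 0 0 0
  simp only [Nat.cast_add, Nat.cast_one] at h
  convert! h using 1
  · simp only [sq]
  · rw [show (fun k : ℕ => (k : ℝ) + 1) = fun k : ℕ => (1 + 1 * k + 0 * (k : ℝ) ^ 2 +
      0 * (k : ℝ) ^ 3 + 0 * (k : ℝ) ^ 4) by ext; ring, h2]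
    ring

theorem integral_poisson_cube : ∫ k : ℕ, (k : ℝ) ^ 3 ∂poissonMeasure r = r ^ 3 + 3 * r ^ 2 + r := by
  have h := integral_poisson_natCast_mul r (g := fun k => (k : ℝ) ^ 2)
    (by simpa using integrable_poisson_add_pow r 2 1)
  have h2 := integral_poisson_quartic r 1 2 1 0 0
  simp only [← pow_succ', Nat.cast_add, Nat.cast_one] at h
  rw [h, show (fun k : ℕ => ((k : ℝ) + 1) ^ 2) = fun k : ℕ => (1 + 2 * k + 1 * (k : ℝ) ^ 2 +
    0 * (k : ℝ) ^ 3 + 0 * (k : ℝ) ^ 4) by ext; ring, h2, integral_poisson_sq]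
  ring

theorem integral_poisson_fourth :
    ∫ k : ℕ, (k : ℝ) ^ 4 ∂poissonMeasure r = r ^ 4 + 6 * r ^ 3 + 7 * r ^ 2 + r := by
  have h := integral_poisson_natCast_mul r (g := fun k => (k : ℝ) ^ 3)
    (by simpa using integrable_poisson_add_pow r 3 1)
  have h2 := integral_poisson_quartic r 1 3 3 1 0
  simp only [← pow_succ', Nat.cast_add, Nat.cast_one] at h
  rw [h, show (fun k : ℕ => ((k : ℝ) + 1) ^ 3) = fun k : ℕ => (1 + 3 * k + 3 * (k : ℝ) ^ 2 +
    1 * (k : ℝ) ^ 3 + 0 * (k : ℝ) ^ 4) by ext; ring, h2, integral_poisson_sq,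
    integral_poisson_cube]
  ring

theorem integrable_poisson_sub_pow (j : ℕ) :
    Integrable (fun k : ℕ => ((k : ℝ) - r) ^ j) (poissonMeasure r) := by
  simpa [sub_eq_add_neg] using integrable_poisson_add_pow r j (-r)

theorem integral_poisson_sub : ∫ k : ℕ, ((k : ℝ) - r) ∂poissonMeasure r = 0 := by
  rw [integral_sub (integrable_poisson_natCast r) (by simp), integral_poisson_natCast]
  simp

theorem integral_poisson_sub_sq : ∫ k : ℕ, ((k : ℝ) - r) ^ 2 ∂poissonMeasure r = r := by
  rw [show (fun k : ℕ => ((k : ℝ) - r) ^ 2) = fun k : ℕ => ((r : ℝ) ^ 2 + -(2 * r) * k +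
    1 * (k : ℝ) ^ 2 + 0 * (k : ℝ) ^ 3 + 0 * (k : ℝ) ^ 4) by ext; ring, integral_poisson_quartic,
    integral_poisson_sq]
  ring

theorem integral_poisson_sub_fourth :
    ∫ k : ℕ, ((k : ℝ) - r) ^ 4 ∂poissonMeasure r = 3 * r ^ 2 + r := by
  rw [show (fun k : ℕ => ((k : ℝ) - r) ^ 4) = fun k : ℕ => ((r : ℝ) ^ 4 + -(4 * (r : ℝ) ^ 3) * k +
    (6 * (r : ℝ) ^ 2) * (k : ℝ) ^ 2 + -(4 * r) * (k : ℝ) ^ 3 + 1 * (k : ℝ) ^ 4) by ext; ring,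
    integral_poisson_quartic, integral_poisson_sq, integral_poisson_cube, integral_poisson_fourth]
  ring

end PoissonMoments

/-! ### Central limit theorem and first absolute moment of `N - N'` -/

section FirstAbsoluteMoment

/-- Truncation costs nothing where `|y| ≤ K`, and at most `|y| ≤ y²/K` elsewhere. -/
theorem abs_integral_abs_sub_min_le (μ : Measure ℝ) [IsProbabilityMeasure μ]
    (h2 : Integrable (fun y => y ^ 2) μ) {K : ℝ} (hK : 0 < K) :
    |∫ y, |y| ∂μ - ∫ y, min |y| K ∂μ| ≤ (∫ y, y ^ 2 ∂μ) / K := by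
  have i1 : Integrable (fun y : ℝ => |y|) μ := by
    refine (h2.add (integrable_const 1)).mono' (by fun_prop) (Eventually.of_forall fun y => ?_)
    simp only [Pi.add_apply, Real.norm_eq_abs, abs_abs]
    nlinarith [sq_abs y, sq_nonneg (|y| - 1)]
  have i2 : Integrable (fun y : ℝ => min |y| K) μ := by
    refine i1.mono' (by fun_prop) (Eventually.of_forall fun y => ?_)
    rw [Real.norm_of_nonneg (le_min (abs_nonneg y) hK.le)]
    exact min_le_left _ _
  rw [← integral_sub i1 i2, ← integral_div]
  refine (abs_integral_le_integral_abs).trans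
    (integral_mono (i1.sub i2).abs (h2.div_const K) fun y => ?_)
  rw [le_div_iff₀ hK, abs_of_nonneg (sub_nonneg.2 (min_le_left _ _)), ← sq_abs y]
  rcases le_total |y| K with h | h
  · rw [min_eq_left h]; simp; positivity
  · rw [min_eq_right h]; nlinarith [abs_nonneg y]

/-- Weak convergence with bounded second moments implies convergence of first absolute moments. -/
theorem tendsto_integral_abs_of_tendsto {μ : ℕ → ProbabilityMeasure ℝ} {ν : ProbabilityMeasure ℝ}
    (h : Tendsto μ atTop (𝓝 ν)) {C : ℝ}
    (hμ : ∀ n, Integrable (fun y => y ^ 2) (μ n : Measure ℝ))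
    (hν : Integrable (fun y => y ^ 2) (ν : Measure ℝ))
    (hμC : ∀ n, ∫ y, y ^ 2 ∂(μ n : Measure ℝ) ≤ C) (hνC : ∫ y, y ^ 2 ∂(ν : Measure ℝ) ≤ C) :
    Tendsto (fun n => ∫ y, |y| ∂(μ n : Measure ℝ)) atTop (𝓝 (∫ y, |y| ∂(ν : Measure ℝ))) := by
  have hC : 0 ≤ C := (integral_nonneg fun y => sq_nonneg y).trans hνC
  rw [Metric.tendsto_atTop']
  intro ε hε
  -- This makes each of the two truncation errors less than `ε/3`, leaving `ε/3` for weak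
  -- convergence; `C + 1` keeps `K` positive when `C = 0`.
  set K : ℝ := 3 * (C + 1) / ε with hKdef
  have hK : 0 < K := by positivity
  have hCK : C / K < ε / 3 := by
    rw [hKdef, div_div_eq_mul_div, div_lt_div_iff₀ (by positivity) (by norm_num)]
    nlinarith
  have hw := (ProbabilityMeasure.tendsto_iff_forall_integral_tendsto.1 h)
    (BoundedContinuousFunction.ofNormedAddCommGroup (fun y : ℝ => min |y| K) (by fun_prop) K
      fun y => by
        rw [Real.norm_of_nonneg (le_min (abs_nonneg y) hK.le)]
        exact min_le_right _ _)
  simp only [BoundedContinuousFunction.coe_ofNormedAddCommGroup] at hw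
  obtain ⟨N, hN⟩ := (Metric.tendsto_atTop'.1 hw) (ε / 3) (by positivity)
  refine ⟨N, fun n hn => ?_⟩
  have h1 := hN n hn
  rw [Real.dist_eq] at h1 ⊢
  have h2 := (abs_integral_abs_sub_min_le (μ n : Measure ℝ) (hμ n) hK).trans
    (div_le_div_of_nonneg_right (hμC n) hK.le)
  have h3 := (abs_integral_abs_sub_min_le (ν : Measure ℝ) hν hK).trans
    (div_le_div_of_nonneg_right hνC hK.le)
  rw [abs_lt] at h1 ⊢
  rw [abs_le] at h2 h3
  constructor <;> linarith [h1.1, h1.2, h2.1, h2.2, h3.1, h3.2]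

theorem integral_abs_gaussianReal {v : ℝ≥0} (hv : v ≠ 0) :
    ∫ y, |y| ∂gaussianReal 0 v = √(2 * v / Real.pi) := by
  have hv' : (0 : ℝ) < v := by positivity
  rw [integral_gaussianReal_eq_integral_smul hv]
  have h : ∀ y : ℝ, gaussianPDFReal 0 v y • |y| =
      (fun z => (√(2 * Real.pi * v))⁻¹ * (z ^ (1 : ℝ) * Real.exp (-(1 / (2 * v)) * z ^ (2 : ℝ)))) |y| := by
    intro y
    simp only [gaussianPDFReal, smul_eq_mul, sub_zero, Real.rpow_one, Real.rpow_ofNat, sq_abs]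
    rw [show -y ^ 2 / (2 * (v : ℝ)) = -(1 / (2 * v)) * y ^ 2 by ring]
    ring
  simp only [h]
  rw [integral_comp_abs (f := fun z => (√(2 * Real.pi * v))⁻¹ *
    (z ^ (1 : ℝ) * Real.exp (-(1 / (2 * v)) * z ^ (2 : ℝ)))), integral_const_mul,
    integral_rpow_mul_exp_neg_mul_rpow (by norm_num) (by norm_num) (by positivity)]
  have e1 : ((1 : ℝ) + 1) / 2 = 1 := by norm_num
  have e2 : -((1 : ℝ) + 1) / 2 = -1 := by norm_num
  rw [e1, e2, Real.Gamma_one, Real.rpow_neg_one]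
  have hp := Real.pi_pos
  symm
  rw [Real.sqrt_eq_iff_mul_self_eq (by positivity) (by positivity)]
  field_simp
  rw [Real.sq_sqrt (by positivity)]

theorem integrable_sq_gaussianReal (v : ℝ≥0) : Integrable (fun y => y ^ 2) (gaussianReal 0 v) :=
  (memLp_id_gaussianReal 2).integrable_sq

theorem integral_sq_gaussianReal (v : ℝ≥0) : ∫ y, y ^ 2 ∂gaussianReal 0 v = v := by
  have h := variance_id_gaussianReal (μ := 0) (v := v)
  rw [variance_eq_sub (memLp_id_gaussianReal 2)] at h
  simpa using h

/-- The law of `c (N - N')`, for `N` and `N'` independent Poisson variables of rate `r`. -/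
noncomputable def scaledSkellam (r : ℝ≥0) (c : ℝ) : Measure ℝ :=
  ((poissonMeasure r).prod (poissonMeasure r)).map fun p : ℕ × ℕ => c * ((p.1 : ℝ) - p.2)

instance (r : ℝ≥0) (c : ℝ) : IsProbabilityMeasure (scaledSkellam r c) :=
  Measure.isProbabilityMeasure_map (by fun_prop)

/-- By independence this is the product of the Poisson characteristic functions at `ct` and `-ct`;
the exponents `r(e^{±ict} - 1)` add up to a real number. -/
theorem charFun_scaledSkellam (r : ℝ≥0) (c t : ℝ) :
    charFun (scaledSkellam r c) t = Complex.exp ((2 * r * (Real.cos (c * t) - 1) : ℝ)) := by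
  have h1 := charFun_map_cast_poissonMeasure r (c * t)
  have h2 := charFun_map_cast_poissonMeasure r (-(c * t))
  rw [charFun_apply_real, integral_map .of_discrete (by fun_prop)] at h1 h2
  rw [scaledSkellam, charFun_apply_real, integral_map (by fun_prop) (by fun_prop)]
  have : ∀ p : ℕ × ℕ, Complex.exp (t * (c * ((p.1 : ℝ) - p.2) : ℝ) * Complex.I) =
      Complex.exp ((c * t : ℝ) * (p.1 : ℝ) * Complex.I) *
        Complex.exp ((-(c * t) : ℝ) * (p.2 : ℝ) * Complex.I) := fun p => by
    rw [← Complex.exp_add]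
    push_cast
    ring_nf
  simp only [this]
  rw [integral_prod_mul (fun k : ℕ => Complex.exp ((c * t : ℝ) * (k : ℝ) * Complex.I))
    (fun k : ℕ => Complex.exp ((-(c * t) : ℝ) * (k : ℝ) * Complex.I)), h1, h2, ← Complex.exp_add]
  congr 1
  push_cast
  rw [Complex.cos]
  ring_nf

theorem integrable_sq_skellam (r : ℝ≥0) :
    Integrable (fun p : ℕ × ℕ => ((p.1 : ℝ) - p.2) ^ 2)
      ((poissonMeasure r).prod (poissonMeasure r)) := by
  have i1 : Integrable (fun k : ℕ => (k : ℝ) - r) (poissonMeasure r) := by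
    simpa using integrable_poisson_sub_pow r 1
  have i2 := integrable_poisson_sub_pow r 2
  refine (((i2.comp_fst (poissonMeasure r)).add (i2.comp_snd (poissonMeasure r))).sub
    ((i1.mul_prod i1).const_mul 2)).congr (Eventually.of_forall fun p => ?_)
  simp only [Pi.add_apply, Pi.sub_apply]
  ring

theorem integral_sq_skellam (r : ℝ≥0) :
    ∫ p : ℕ × ℕ, ((p.1 : ℝ) - p.2) ^ 2 ∂((poissonMeasure r).prod (poissonMeasure r)) = 2 * r := by
  have i1 : Integrable (fun k : ℕ => (k : ℝ) - r) (poissonMeasure r) := by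
    simpa using integrable_poisson_sub_pow r 1
  have i2 := integrable_poisson_sub_pow r 2
  -- After centring both coordinates, the cross term integrates to zero.
  have e : ∀ p : ℕ × ℕ, ((p.1 : ℝ) - p.2) ^ 2 =
      (((p.1 : ℝ) - r) ^ 2 + ((p.2 : ℝ) - r) ^ 2) - 2 * (((p.1 : ℝ) - r) * ((p.2 : ℝ) - r)) :=
    fun p => by ring
  have j1 := i2.comp_fst (poissonMeasure r)
  have j2 := i2.comp_snd (poissonMeasure r)
  have j3 : Integrable (fun p : ℕ × ℕ => ((p.1 : ℝ) - r) ^ 2 + ((p.2 : ℝ) - r) ^ 2)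
    ((poissonMeasure r).prod (poissonMeasure r)) := j1.add j2
  simp only [e]
  rw [integral_sub j3 ((i1.mul_prod i1).const_mul 2), integral_add j1 j2, integral_const_mul,
    integral_prod_mul (fun k : ℕ => (k : ℝ) - r) (fun k : ℕ => (k : ℝ) - r), integral_poisson_sub,
    integral_fun_fst (fun k : ℕ => ((k : ℝ) - r) ^ 2),
    integral_fun_snd (fun k : ℕ => ((k : ℝ) - r) ^ 2), integral_poisson_sub_sq]
  simp
  ring

theorem integrable_sq_scaledSkellam (r : ℝ≥0) (c : ℝ) :
    Integrable (fun y => y ^ 2) (scaledSkellam r c) := by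
  rw [scaledSkellam, integrable_map_measure (by fun_prop) (by fun_prop)]
  simpa [Function.comp_def, mul_pow] using (integrable_sq_skellam r).const_mul (c ^ 2)

theorem integral_sq_scaledSkellam (r : ℝ≥0) (c : ℝ) :
    ∫ y, y ^ 2 ∂scaledSkellam r c = c ^ 2 * (2 * r) := by
  rw [scaledSkellam, integral_map (by fun_prop) (by fun_prop), ← integral_sq_skellam,
    ← integral_const_mul]
  simp only [mul_pow]

theorem integral_abs_scaledSkellam (r : ℝ≥0) (c : ℝ) :
    ∫ y, |y| ∂scaledSkellam r c =
      |c| * ∫ p : ℕ × ℕ, |(p.1 : ℝ) - p.2| ∂((poissonMeasure r).prod (poissonMeasure r)) := by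
  rw [scaledSkellam, integral_map (by fun_prop) (by fun_prop), ← integral_const_mul]
  simp only [abs_mul]

/-- The left side is the exponent of the characteristic function of `(N-N')/√m`, the limit that of a
centred Gaussian of variance `2x`. Half-angle formulas reduce the claim to `sinc → 1` at `0`. -/
theorem tendsto_mul_cos_sub_one (x t : ℝ) :
    Tendsto (fun m : ℝ => 2 * (m * x) * (Real.cos ((√m)⁻¹ * t) - 1)) atTop (𝓝 (-(x * t ^ 2))) := by
  have hs : Tendsto (fun m : ℝ => (√m)⁻¹ * t / 2) atTop (𝓝 0) := by
    simpa using ((tendsto_inv_atTop_zero.comp Real.tendsto_sqrt_atTop).mul_const t).div_const 2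
  have hsinc : Tendsto (fun m : ℝ => Real.sinc ((√m)⁻¹ * t / 2)) atTop (𝓝 1) := by
    simpa [Function.comp_def] using (Real.continuous_sinc.tendsto 0).comp hs
  have := (hsinc.pow 2).const_mul (-(x * t ^ 2))
  rw [one_pow, mul_one] at this
  refine this.congr' ?_
  filter_upwards [eventually_gt_atTop 0] with m hm
  have hsm : 0 < √m := Real.sqrt_pos.2 hm
  have hcos : Real.cos ((√m)⁻¹ * t) - 1 = -(2 * Real.sin ((√m)⁻¹ * t / 2) ^ 2) := by
    have h1 := Real.cos_sq' ((√m)⁻¹ * t / 2)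
    have h2 := Real.cos_sq ((√m)⁻¹ * t / 2)
    rw [mul_div_cancel₀ _ (two_ne_zero)] at h2
    linarith
  rw [hcos]
  rcases eq_or_ne t 0 with rfl | ht
  · simp
  rw [Real.sinc_of_ne_zero (by positivity)]
  have hm2 : √m ^ 2 = m := Real.sq_sqrt hm.le
  field_simp
  rw [hm2]
  ring

/-- Lévy's continuity theorem gives the Gaussian limit, and the uniform second moment bound `2x`
transfers it to first absolute moments. -/
theorem tendsto_scaled_abs_skellam {x : ℝ} (hx : 0 < x) :
    Tendsto (fun m : ℝ => (√m)⁻¹ * ∫ p : ℕ × ℕ, |(p.1 : ℝ) - p.2|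
      ∂((poissonMeasure (m * x).toNNReal).prod (poissonMeasure (m * x).toNNReal)))
      atTop (𝓝 (2 * √(x / Real.pi))) := by
  refine tendsto_of_seq_tendsto fun u hu => ?_
  set v : ℝ≥0 := (2 * x).toNNReal with hv
  have hvx : (v : ℝ) = 2 * x := Real.coe_toNNReal _ (by positivity)
  have hv0 : v ≠ 0 := by
    rw [← NNReal.coe_ne_zero, hvx]
    positivity
  let μ : ℕ → ProbabilityMeasure ℝ := fun n =>
    ⟨scaledSkellam (u n * x).toNNReal (√(u n))⁻¹, inferInstance⟩
  let ν : ProbabilityMeasure ℝ := ⟨gaussianReal 0 v, inferInstance⟩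
  have hw : Tendsto μ atTop (𝓝 ν) := by
    rw [ProbabilityMeasure.tendsto_iff_tendsto_charFun]
    intro t
    simp only [μ, ν, ProbabilityMeasure.coe_mk, charFun_scaledSkellam, charFun_gaussianReal]
    have h1 := (Complex.continuous_exp.comp Complex.continuous_ofReal).continuousAt.tendsto.comp
      ((tendsto_mul_cos_sub_one x t).comp hu)
    convert! h1.congr' ?_ using 2
    · simp only [Function.comp_apply, hvx, Complex.ofReal_zero, mul_zero, zero_mul, zero_sub]
      push_cast
      ring_nf
    · filter_upwards [hu.eventually_gt_atTop 0] with n hn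
      simp only [Function.comp_apply]
      rw [Real.coe_toNNReal _ (by positivity)]
  have hC : ∀ n, ∫ y, y ^ 2 ∂(μ n : Measure ℝ) ≤ 2 * x := fun n => by
    simp only [μ, ProbabilityMeasure.coe_mk, integral_sq_scaledSkellam]
    -- For the early terms with `u n ≤ 0`, the conventions for `√` and inverse make the scale `0`,
    -- so the second moment vanishes.
    rcases le_or_gt (u n) 0 with h | h
    · rw [Real.sqrt_eq_zero_of_nonpos h]; simp; positivity
    · rw [Real.coe_toNNReal _ (by positivity), inv_pow, Real.sq_sqrt h.le]
      apply le_of_eq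
      field_simp
  have := tendsto_integral_abs_of_tendsto hw (fun n => integrable_sq_scaledSkellam _ _)
    (integrable_sq_gaussianReal v) hC ((integral_sq_gaussianReal v).trans hvx).le
  simp only [μ, ν, ProbabilityMeasure.coe_mk, integral_abs_scaledSkellam,
    integral_abs_gaussianReal hv0, hvx] at this
  convert! this using 2
  · rw [Function.comp_apply, abs_of_nonneg (by positivity)]
  · rw [show 2 * (2 * x) / Real.pi = 2 ^ 2 * (x / Real.pi) by ring, Real.sqrt_mul (by positivity),
      Real.sqrt_sq (by norm_num)]

end FirstAbsoluteMoment

/-! ### Taylor estimates on the half-line -/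

section Taylor

variable {F f f' : ℝ → ℝ} {x : ℝ}

/-- The mean value inequality for `g z - c z` on the segment from `x` to `y`, which stays in `[0,
∞)`. -/
theorem abs_sub_sub_mul_le_of_hasDerivWithinAt {g g' : ℝ → ℝ} {C y : ℝ} (hx : 0 ≤ x) (hy : 0 ≤ y)
    (c : ℝ) (hg : ∀ z ∈ Set.Ici (0 : ℝ), HasDerivWithinAt g (g' z) (Set.Ici 0) z)
    (hC : ∀ z ∈ Set.uIcc x y, |g' z - c| ≤ C) :
    |g y - g x - c * (y - x)| ≤ C * |y - x| := by
  have hsub : Set.uIcc x y ⊆ Set.Ici 0 := fun z hz => (le_min hx hy).trans hz.1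
  have := (convex_uIcc x y).norm_image_sub_le_of_norm_hasDerivWithin_le
    (f := fun z => g z - c * z) (f' := fun z => g' z - c * 1) (C := C)
    (fun z hz => ((hg z (hsub hz)).mono hsub).sub ((hasDerivWithinAt_id z _).const_mul c))
    (fun z hz => by simpa using hC z hz) Set.left_mem_uIcc Set.right_mem_uIcc
  simp only [Real.norm_eq_abs] at this
  convert! this using 2
  ring

theorem abs_taylor_one_le {C : ℝ} (hx : 0 ≤ x)
    (hf : ∀ y ∈ Set.Ici (0 : ℝ), HasDerivWithinAt F (f y) (Set.Ici 0) y)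
    (hf' : ∀ y ∈ Set.Ici (0 : ℝ), HasDerivWithinAt f (f' y) (Set.Ici 0) y)
    (hC : ∀ y ∈ Set.Ici (0 : ℝ), |f' y| ≤ C) {y : ℝ} (hy : 0 ≤ y) :
    |F y - F x - f x * (y - x)| ≤ C * (y - x) ^ 2 := by
  have hC0 : 0 ≤ C := (abs_nonneg _).trans (hC 0 Set.self_mem_Ici)
  have := abs_sub_sub_mul_le_of_hasDerivWithinAt (C := C * |y - x|) hx hy (f x) hf fun z hz => by
    have hz0 : 0 ≤ z := (le_min hx hy).trans hz.1
    have h := abs_sub_sub_mul_le_of_hasDerivWithinAt (C := C) hx hz0 0 hf' fun w hw => by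
      simpa using hC w ((le_min hx hz0).trans hw.1)
    simp only [zero_mul, sub_zero] at h
    exact h.trans (mul_le_mul_of_nonneg_left (Set.abs_sub_left_of_mem_uIcc hz) hC0)
  rwa [mul_assoc, abs_mul_abs_self, ← sq] at this

/-- Near `x`, differentiability of `f` at `x` gives the `ε` term. At distance at least `δ`, the
crude quadratic bound is absorbed by a fourth power, whose Poisson expectation is of smaller order.
-/
theorem exists_abs_taylor_two_le {C : ℝ} (hx : 0 ≤ x)
    (hf : ∀ y ∈ Set.Ici (0 : ℝ), HasDerivWithinAt F (f y) (Set.Ici 0) y)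
    (hf' : ∀ y ∈ Set.Ici (0 : ℝ), HasDerivWithinAt f (f' y) (Set.Ici 0) y)
    (hC : ∀ y ∈ Set.Ici (0 : ℝ), |f' y| ≤ C) {ε : ℝ} (hε : 0 < ε) :
    ∃ K, 0 ≤ K ∧ ∀ y, 0 ≤ y →
      |F y - F x - f x * (y - x) - f' x / 2 * (y - x) ^ 2| ≤
        ε * (y - x) ^ 2 + K * (y - x) ^ 4 := by
  have hC0 : 0 ≤ C := (abs_nonneg _).trans (hC 0 Set.self_mem_Ici)
  have h1 := (hasDerivWithinAt_iff_isLittleO.1 (hf' x hx)).def hε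
  obtain ⟨δ, hδ, hball⟩ := Metric.mem_nhdsWithin_iff.1 h1
  refine ⟨(C + |f' x| / 2) / δ ^ 2, by positivity, fun y hy => ?_⟩
  rcases lt_or_ge |y - x| δ with hlt | hge
  -- With the quadratic term subtracted, the derivative stays within `ε|y - x|` of `f x` on the
  -- segment.
  · have hd : ∀ z ∈ Set.Ici (0 : ℝ), HasDerivWithinAt (fun z => F z - f' x / 2 * (z - x) ^ 2)
        (f z - f' x * (z - x)) (Set.Ici 0) z := fun z hz => by
      refine ((hf z hz).sub ((((hasDerivWithinAt_id z _).sub_const x).pow 2).const_mul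
        (f' x / 2))).congr_deriv ?_
      simp
      ring
    have := abs_sub_sub_mul_le_of_hasDerivWithinAt (C := ε * |y - x|) hx hy (f x) hd fun z hz => by
      have hz0 : 0 ≤ z := (le_min hx hy).trans hz.1
      have hzy := Set.abs_sub_left_of_mem_uIcc hz
      have h := hball (a := z) ⟨by rw [Metric.mem_ball, Real.dist_eq]; exact hzy.trans_lt hlt, hz0⟩
      simp only [Set.mem_ofPred_eq, smul_eq_mul, Real.norm_eq_abs] at h
      calc |f z - f' x * (z - x) - f x| = |f z - f x - (z - x) * f' x| := by ring_nf
        _ ≤ ε * |z - x| := h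
        _ ≤ ε * |y - x| := mul_le_mul_of_nonneg_left hzy hε.le
    rw [mul_assoc, abs_mul_abs_self, ← sq] at this
    calc |F y - F x - f x * (y - x) - f' x / 2 * (y - x) ^ 2|
        = |F y - f' x / 2 * (y - x) ^ 2 - (F x - f' x / 2 * (x - x) ^ 2) - f x * (y - x)| := by
          ring_nf
      _ ≤ ε * (y - x) ^ 2 := this
      _ ≤ _ := le_add_of_nonneg_right (by positivity)
  · have h := abs_taylor_one_le hx hf hf' hC hy
    have hδ2 : δ ^ 2 ≤ (y - x) ^ 2 := by
      rw [← sq_abs (y - x)]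
      exact pow_le_pow_left₀ hδ.le hge 2
    have h2 : (C + |f' x| / 2) * (y - x) ^ 2 ≤ (C + |f' x| / 2) / δ ^ 2 * (y - x) ^ 4 := by
      rw [div_mul_eq_mul_div, le_div_iff₀ (by positivity), mul_assoc]
      refine mul_le_mul_of_nonneg_left ?_ (by positivity)
      nlinarith [sq_nonneg (y - x)]
    have h3 := abs_sub (F y - F x - f x * (y - x)) (f' x / 2 * (y - x) ^ 2)
    have h4 : |f' x / 2 * (y - x) ^ 2| = |f' x| / 2 * (y - x) ^ 2 := by
      rw [abs_mul, abs_div, abs_two, abs_of_nonneg (sq_nonneg (y - x))]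
    have h5 : 0 ≤ ε * (y - x) ^ 2 := by positivity
    linarith

end Taylor

/-! ### Asymptotics of the bias and of the variance -/

section Moments

variable {F f f' : ℝ → ℝ} {x : ℝ}

/-- The mean `E F(N / m)` of the estimator, with `N` Poisson of rate `m x`. -/
noncomputable def poissonMean (F : ℝ → ℝ) (x m : ℝ) : ℝ :=
  ∫ k : ℕ, F (k / m) ∂poissonMeasure (m * x).toNNReal

/-- `E F(min(N, N') / m)`, with `N` and `N'` independent Poisson of rate `m x`. -/
noncomputable def poissonMinMean (F : ℝ → ℝ) (x m : ℝ) : ℝ :=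
  ∫ p : ℕ × ℕ, F ((min p.1 p.2 : ℕ) / m)
    ∂((poissonMeasure (m * x).toNNReal).prod (poissonMeasure (m * x).toNNReal))

theorem integrable_of_mem_Icc {α : Type*} [MeasurableSpace α] [DiscreteMeasurableSpace α]
    {μ : Measure α} [IsFiniteMeasure μ] {F : ℝ → ℝ} (hF : ∀ y, F y ∈ Set.Icc (0 : ℝ) 1)
    (g : α → ℝ) : Integrable (fun a => F (g a)) μ :=
  Integrable.of_bound (Measurable.of_discrete).aestronglyMeasurable 1 (Eventually.of_forall fun a => by
    rw [Real.norm_of_nonneg (hF _).1]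
    exact (hF _).2)

/-- `N/m - x` has mean `0`, variance `x/m` and fourth moment `O(m⁻²)`, so after multiplication by
`m` only the quadratic Taylor term survives. -/
theorem tendsto_mul_poissonMean_sub (hx : 0 < x) (hF : ∀ y, F y ∈ Set.Icc (0 : ℝ) 1)
    (hf : ∀ y ∈ Set.Ici (0 : ℝ), HasDerivWithinAt F (f y) (Set.Ici 0) y)
    (hf' : ∀ y ∈ Set.Ici (0 : ℝ), HasDerivWithinAt f (f' y) (Set.Ici 0) y)
    (hf'bdd : ∃ C, ∀ y ∈ Set.Ici (0 : ℝ), |f' y| ≤ C) :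
    Tendsto (fun m => m * (poissonMean F x m - F x)) atTop (𝓝 (b f' x)) := by
  obtain ⟨C, hC⟩ := hf'bdd
  rw [Metric.tendsto_nhds]
  intro ε hε
  -- The variance `x/m`, multiplied by `m`, turns this tolerance into `ε/2`.
  obtain ⟨K, hK0, hK⟩ := exists_abs_taylor_two_le hx.le hf hf' hC (ε := ε / (2 * x)) (by positivity)
  have hlim : Tendsto (fun m : ℝ => K * (3 * x ^ 2 * m⁻¹ + x * m⁻¹ ^ 2)) atTop (𝓝 0) := by
    have h := tendsto_inv_atTop_zero (𝕜 := ℝ)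
    simpa using ((h.const_mul (3 * x ^ 2)).add ((h.pow 2).const_mul x)).const_mul K
  filter_upwards [eventually_gt_atTop 0, hlim.eventually_lt_const (half_pos hε)] with m hm hmε
  set r : ℝ≥0 := (m * x).toNNReal with hr
  have hrx : (r : ℝ) = m * x := Real.coe_toNNReal _ (by positivity)
  have e : ∀ k : ℕ, ((k : ℝ) / m - x) = m⁻¹ * ((k : ℝ) - r) := fun k => by
    rw [hrx]; field_simp
  have iF : Integrable (fun k : ℕ => F (k / m)) (poissonMeasure r) := integrable_of_mem_Icc hF _
  have i1 : Integrable (fun k : ℕ => (k : ℝ) / m - x) (poissonMeasure r) := by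
    simp only [e]; simpa using (integrable_poisson_sub_pow r 1).const_mul m⁻¹
  have i2 : Integrable (fun k : ℕ => ((k : ℝ) / m - x) ^ 2) (poissonMeasure r) := by
    simp only [e, mul_pow]; exact (integrable_poisson_sub_pow r 2).const_mul _
  have i4 : Integrable (fun k : ℕ => ((k : ℝ) / m - x) ^ 4) (poissonMeasure r) := by
    simp only [e, mul_pow]; exact (integrable_poisson_sub_pow r 4).const_mul _
  have v1 : ∫ k : ℕ, ((k : ℝ) / m - x) ∂poissonMeasure r = 0 := by
    simp only [e]; rw [integral_const_mul, integral_poisson_sub, mul_zero]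
  have v2 : ∫ k : ℕ, ((k : ℝ) / m - x) ^ 2 ∂poissonMeasure r = x / m := by
    simp only [e, mul_pow]; rw [integral_const_mul, integral_poisson_sub_sq, hrx]; field_simp
  have v4 : ∫ k : ℕ, ((k : ℝ) / m - x) ^ 4 ∂poissonMeasure r =
      m⁻¹ * (3 * x ^ 2 * m⁻¹ + x * m⁻¹ ^ 2) := by
    simp only [e, mul_pow]; rw [integral_const_mul, integral_poisson_sub_fourth, hrx]; field_simp
  have j0 : Integrable (fun k : ℕ => F (k / m) - F x) (poissonMeasure r) :=
    iF.sub (integrable_const _)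
  have j1 : Integrable (fun k : ℕ => F (k / m) - F x - f x * (k / m - x)) (poissonMeasure r) :=
    j0.sub (i1.const_mul _)
  have hR : ∫ k : ℕ, (F (k / m) - F x - f x * (k / m - x) - f' x / 2 * (k / m - x) ^ 2)
      ∂poissonMeasure r = poissonMean F x m - F x - m⁻¹ * b f' x := by
    rw [integral_sub j1 (i2.const_mul _), integral_sub j0 (i1.const_mul _),
      integral_sub iF (integrable_const _), integral_const_mul, integral_const_mul, v1, v2]
    simp only [poissonMean, b, integral_const, probReal_univ, one_smul, ← hr]
    ring
  have hbound : |poissonMean F x m - F x - m⁻¹ * b f' x| ≤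
      ε / (2 * x) * (x / m) + K * (m⁻¹ * (3 * x ^ 2 * m⁻¹ + x * m⁻¹ ^ 2)) := by
    rw [← hR, ← v2, ← v4, ← integral_const_mul, ← integral_const_mul,
      ← integral_add (i2.const_mul _) (i4.const_mul _)]
    exact abs_integral_le_integral_abs.trans (integral_mono (j1.sub (i2.const_mul _)).abs
      ((i2.const_mul _).add (i4.const_mul _)) fun k => hK _ (by positivity))
  rw [Real.dist_eq]
  calc |m * (poissonMean F x m - F x) - b f' x|
      = m * |poissonMean F x m - F x - m⁻¹ * b f' x| := by
        rw [← abs_of_pos hm, ← abs_mul, abs_of_pos hm]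
        congr 1
        field_simp
    _ ≤ m * (ε / (2 * x) * (x / m) + K * (m⁻¹ * (3 * x ^ 2 * m⁻¹ + x * m⁻¹ ^ 2))) :=
        mul_le_mul_of_nonneg_left hbound hm.le
    _ = ε / 2 + K * (3 * x ^ 2 * m⁻¹ + x * m⁻¹ ^ 2) := by field_simp
    _ < ε := by linarith

/-- The first-order Taylor term contributes `-f(x) E|N-N'|/(2m)`; the remainder is `O(1/m)`, hence
negligible against `1/√m`. -/
theorem tendsto_sqrt_mul_poissonMinMean_sub (hx : 0 < x) (hF : ∀ y, F y ∈ Set.Icc (0 : ℝ) 1)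
    (hf : ∀ y ∈ Set.Ici (0 : ℝ), HasDerivWithinAt F (f y) (Set.Ici 0) y)
    (hf' : ∀ y ∈ Set.Ici (0 : ℝ), HasDerivWithinAt f (f' y) (Set.Ici 0) y)
    (hf'bdd : ∃ C, ∀ y ∈ Set.Ici (0 : ℝ), |f' y| ≤ C) :
    Tendsto (fun m => √m * (poissonMinMean F x m - F x)) atTop (𝓝 (-V f x)) := by
  obtain ⟨C, hC⟩ := hf'bdd
  have hC0 : 0 ≤ C := (abs_nonneg _).trans (hC 0 Set.self_mem_Ici)
  have hmain := (tendsto_scaled_abs_skellam hx).const_mul (-(f x / 2))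
  have hval : -(f x / 2) * (2 * √(x / Real.pi)) = -V f x := by
    rw [V, Real.sqrt_eq_rpow]
    ring
  rw [hval] at hmain
  have hlim : Tendsto (fun m : ℝ => C * (2 * x) * (√m)⁻¹) atTop (𝓝 0) := by
    simpa using (tendsto_inv_atTop_zero.comp Real.tendsto_sqrt_atTop).const_mul (C * (2 * x))
  rw [← sub_zero (-V f x)]
  have hrem : Tendsto (fun m : ℝ => -(f x / 2) * ((√m)⁻¹ * ∫ p : ℕ × ℕ, |(p.1 : ℝ) - p.2|
      ∂((poissonMeasure (m * x).toNNReal).prod (poissonMeasure (m * x).toNNReal))) -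
      √m * (poissonMinMean F x m - F x)) atTop (𝓝 0) := by
    refine squeeze_zero_norm' ?_ hlim
    filter_upwards [eventually_gt_atTop 0] with m hm
    set r : ℝ≥0 := (m * x).toNNReal with hr
    have hrx : (r : ℝ) = m * x := Real.coe_toNNReal _ (by positivity)
    set μ := (poissonMeasure r).prod (poissonMeasure r) with hμ
    have hmin : ∀ p : ℕ × ℕ, ((min p.1 p.2 : ℕ) : ℝ) / m - x =
        m⁻¹ * (((p.1 : ℝ) - r) / 2 + ((p.2 : ℝ) - r) / 2 - |(p.1 : ℝ) - p.2| / 2) := fun p => by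
      rw [hrx, Nat.cast_min]
      have : min (p.1 : ℝ) p.2 = (p.1 : ℝ) / 2 + (p.2 : ℝ) / 2 - |(p.1 : ℝ) - p.2| / 2 := by
        rcases le_total (p.1 : ℝ) p.2 with h | h
        · rw [min_eq_left h, abs_of_nonpos (sub_nonpos.2 h)]; ring
        · rw [min_eq_right h, abs_of_nonneg (sub_nonneg.2 h)]; ring
      rw [this]
      field_simp
      ring
    have s1 : Integrable (fun k : ℕ => (k : ℝ) - r) (poissonMeasure r) := by
      simpa using integrable_poisson_sub_pow r 1
    have s2 := integrable_poisson_sub_pow r 2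
    have a1 : Integrable (fun p : ℕ × ℕ => ((p.1 : ℝ) - r) / 2) μ :=
      (s1.comp_fst (poissonMeasure r)).div_const 2
    have a2 : Integrable (fun p : ℕ × ℕ => ((p.2 : ℝ) - r) / 2) μ :=
      (s1.comp_snd (poissonMeasure r)).div_const 2
    have a3 : Integrable (fun p : ℕ × ℕ => |(p.1 : ℝ) - p.2| / 2) μ := by
      refine Integrable.div_const (Integrable.abs ?_) 2
      refine (((s1.comp_fst (poissonMeasure r))).sub (s1.comp_snd (poissonMeasure r))).congr
        (Eventually.of_forall fun p => ?_)
      simp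
    have a12 : Integrable (fun p : ℕ × ℕ => ((p.1 : ℝ) - r) / 2 + ((p.2 : ℝ) - r) / 2) μ :=
      a1.add a2
    have b1 : Integrable (fun p : ℕ × ℕ => ((min p.1 p.2 : ℕ) : ℝ) / m - x) μ := by
      simp only [hmin]
      exact (a12.sub a3).const_mul _
    have vb : ∫ p : ℕ × ℕ, (((min p.1 p.2 : ℕ) : ℝ) / m - x) ∂μ =
        -(m⁻¹ * (∫ p : ℕ × ℕ, |(p.1 : ℝ) - p.2| ∂μ) / 2) := by
      simp only [hmin]
      rw [integral_const_mul, integral_sub a12 a3, integral_add a1 a2, integral_div, integral_div,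
        integral_div, integral_fun_fst (fun k : ℕ => (k : ℝ) - r),
        integral_fun_snd (fun k : ℕ => (k : ℝ) - r), integral_poisson_sub]
      simp
      ring
    have c1 : Integrable (fun p : ℕ × ℕ => ((p.1 : ℝ) - r) ^ 2) μ := s2.comp_fst (poissonMeasure r)
    have c2 : Integrable (fun p : ℕ × ℕ => ((p.2 : ℝ) - r) ^ 2) μ := s2.comp_snd (poissonMeasure r)
    have iF : Integrable (fun p : ℕ × ℕ => F ((min p.1 p.2 : ℕ) / m)) μ :=
      integrable_of_mem_Icc hF _
    have j0 : Integrable (fun p : ℕ × ℕ => F ((min p.1 p.2 : ℕ) / m) - F x) μ :=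
      iF.sub (integrable_const _)
    have hR : ∫ p : ℕ × ℕ, (F ((min p.1 p.2 : ℕ) / m) - F x -
        f x * (((min p.1 p.2 : ℕ) : ℝ) / m - x)) ∂μ =
        poissonMinMean F x m - F x + f x * (m⁻¹ * (∫ p : ℕ × ℕ, |(p.1 : ℝ) - p.2| ∂μ) / 2) := by
      rw [integral_sub j0 (b1.const_mul _), integral_sub iF (integrable_const _),
        integral_const_mul, vb]
      simp only [poissonMinMean, integral_const, probReal_univ, one_smul, ← hr, ← hμ]
      ring
    have hpt : ∀ p : ℕ × ℕ, |F ((min p.1 p.2 : ℕ) / m) - F x -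
        f x * (((min p.1 p.2 : ℕ) : ℝ) / m - x)| ≤
        C * m⁻¹ ^ 2 * (((p.1 : ℝ) - r) ^ 2 + ((p.2 : ℝ) - r) ^ 2) := fun p => by
      refine (abs_taylor_one_le hx.le hf hf' hC (by positivity)).trans ?_
      have e : ((min p.1 p.2 : ℕ) : ℝ) / m - x = m⁻¹ * (((min p.1 p.2 : ℕ) : ℝ) - r) := by
        rw [hrx]; field_simp
      rw [e, mul_pow, ← mul_assoc]
      refine mul_le_mul_of_nonneg_left ?_ (by positivity)
      -- The minimum is one of the coordinates, so its squared deviation is at most the sum of both.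
      rcases min_choice p.1 p.2 with h | h <;> rw [h]
      · exact le_add_of_nonneg_right (sq_nonneg _)
      · exact le_add_of_nonneg_left (sq_nonneg _)
    have c12 : Integrable (fun p : ℕ × ℕ => ((p.1 : ℝ) - r) ^ 2 + ((p.2 : ℝ) - r) ^ 2) μ :=
      c1.add c2
    have hbound : |poissonMinMean F x m - F x +
        f x * (m⁻¹ * (∫ p : ℕ × ℕ, |(p.1 : ℝ) - p.2| ∂μ) / 2)| ≤ C * m⁻¹ ^ 2 * (r + r) := by
      rw [← hR]
      refine abs_integral_le_integral_abs.trans ((integral_mono (j0.sub (b1.const_mul _)).abs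
        (c12.const_mul _) hpt).trans_eq ?_)
      rw [integral_const_mul, integral_add c1 c2,
        integral_fun_fst (fun k : ℕ => ((k : ℝ) - r) ^ 2),
        integral_fun_snd (fun k : ℕ => ((k : ℝ) - r) ^ 2), integral_poisson_sub_sq]
      simp
    have hs : 0 < √m := Real.sqrt_pos.2 hm
    have hsm : √m * m⁻¹ = (√m)⁻¹ := by
      nth_rewrite 2 [← Real.mul_self_sqrt hm.le]
      field_simp
    have hmm : m⁻¹ ^ 2 * (m * x + m * x) = m⁻¹ * (2 * x) := by
      field_simp
      ring
    rw [Real.norm_eq_abs]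
    calc |-(f x / 2) * ((√m)⁻¹ * ∫ p : ℕ × ℕ, |(p.1 : ℝ) - p.2| ∂μ) -
          √m * (poissonMinMean F x m - F x)|
        = √m * |poissonMinMean F x m - F x +
            f x * (m⁻¹ * (∫ p : ℕ × ℕ, |(p.1 : ℝ) - p.2| ∂μ) / 2)| := by
          rw [← abs_neg, ← abs_of_pos hs, ← abs_mul, abs_of_pos hs]
          congr 1
          linear_combination -(f x * (∫ p : ℕ × ℕ, |(p.1 : ℝ) - p.2| ∂μ) / 2) * hsm
      _ ≤ √m * (C * m⁻¹ ^ 2 * (r + r)) := mul_le_mul_of_nonneg_left hbound hs.le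
      _ = C * (2 * x) * (√m)⁻¹ := by
          rw [hrx]
          linear_combination √m * C * hmm + C * (2 * x) * hsm
  refine (hmain.sub hrem).congr fun m => ?_
  ring

/-- The variance of one summand of the estimator is `σ² - m^{-1/2} V + o(m^{-1/2})`. -/
theorem tendsto_sqrt_mul_variance_sub (hx : 0 < x) (hF : ∀ y, F y ∈ Set.Icc (0 : ℝ) 1)
    (hf : ∀ y ∈ Set.Ici (0 : ℝ), HasDerivWithinAt F (f y) (Set.Ici 0) y)
    (hf' : ∀ y ∈ Set.Ici (0 : ℝ), HasDerivWithinAt f (f' y) (Set.Ici 0) y)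
    (hf'bdd : ∃ C, ∀ y ∈ Set.Ici (0 : ℝ), |f' y| ≤ C) :
    Tendsto (fun m => √m * (poissonMinMean F x m - poissonMean F x m ^ 2 - sigmaSq F x)) atTop
      (𝓝 (-V f x)) := by
  have h1 := tendsto_sqrt_mul_poissonMinMean_sub hx hF hf hf' hf'bdd
  have h2 := tendsto_mul_poissonMean_sub hx hF hf hf' hf'bdd
  have h3 : Tendsto (fun m : ℝ => (√m)⁻¹) atTop (𝓝 0) :=
    tendsto_inv_atTop_zero.comp Real.tendsto_sqrt_atTop
  have h4 : Tendsto (fun m => (√m)⁻¹ * (m * (poissonMean F x m - F x))) atTop (𝓝 0) := by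
    simpa using h3.mul h2
  have h5 : Tendsto (fun m : ℝ => m⁻¹ * (m * (poissonMean F x m - F x))) atTop (𝓝 0) := by
    simpa using tendsto_inv_atTop_zero.mul h2
  -- With `μ` the mean, `μ² - F² = (μ - F)((μ - F) + 2F)`; the factor `√m (μ - F)` tends to `0`.
  have h6 := h1.sub (h4.mul (h5.add_const (2 * F x)))
  simp only [zero_add, zero_mul, sub_zero] at h6
  refine h6.congr' ?_
  filter_upwards [eventually_gt_atTop 0] with m hm
  have hs : √m ≠ 0 := (Real.sqrt_pos.2 hm).ne'
  have e1 : (√m)⁻¹ * (m * (poissonMean F x m - F x)) = √m * (poissonMean F x m - F x) := by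
    nth_rewrite 2 [← Real.mul_self_sqrt hm.le]
    field_simp
  rw [e1, inv_mul_cancel_left₀ hm.ne', sigmaSq]
  ring

end Moments

/-- The kernel `t ↦ P(t ≤ N / m)`, with `N` Poisson of rate `m x`; the estimator is its empirical
mean. -/
noncomputable def tail (m x t : ℝ) : ℝ :=
  (poissonMeasure (m * x).toNNReal).real {k : ℕ | t ≤ k / m}

theorem measurable_tail (m x : ℝ) : Measurable (tail m x) :=
  Antitone.measurable fun _ _ hst => measureReal_mono fun _ hk => hst.trans hk

theorem abs_tail_le (m x t : ℝ) : |tail m x t| ≤ 1 := by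
  rw [tail, abs_of_nonneg measureReal_nonneg]
  exact measureReal_le_one

/-- The series is a Poisson integral, which commutes with the finite sum over the sample. -/
theorem estimator_eq_sum_tail {Ω : Type*} (X : ℕ → Ω → ℝ) {m x : ℝ} (hm : 0 < m) (hx : 0 < x)
    (n : ℕ) (ω : Ω) :
    estimator X m n ω x = ∑ i ∈ Finset.range n, (1 / (n : ℝ)) * tail m x (X i ω) := by
  have hrx : (((m * x).toNNReal : ℝ≥0) : ℝ) = m * x := Real.coe_toNNReal _ (by positivity)
  have h1 : estimator X m n ω x =
      ∫ k : ℕ, edf X n ω (k / m) ∂poissonMeasure (m * x).toNNReal := by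
    rw [integral_poissonMeasure, estimator]
    simp only [weight, hrx, smul_eq_mul, mul_comm]
  have hi : ∀ i, Integrable (fun k : ℕ => Set.indicator (Set.Iic ((k : ℝ) / m))
      (fun _ => (1 : ℝ)) (X i ω)) (poissonMeasure (m * x).toNNReal) := fun i =>
    Integrable.of_bound Measurable.of_discrete.aestronglyMeasurable 1 (Eventually.of_forall fun k =>
      (norm_indicator_le_norm_self _ _).trans (by simp))
  rw [h1]
  simp only [edf]
  rw [integral_const_mul, integral_finsetSum _ fun i _ => hi i, Finset.mul_sum]
  refine Finset.sum_congr rfl fun i _ => ?_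
  rw [tail, ← integral_indicator_one (.of_discrete)]
  rfl

/-! ### Bias-variance decomposition -/

section MeanSquaredError

variable {Ω : Type*} [MeasurableSpace Ω] {P : Measure Ω} [IsProbabilityMeasure P]

/-- Fubini for the indicator of `Y ω ≤ h a`. It is applied with `α = ℕ` for the mean and `α = ℕ × ℕ`
for the second moment. -/
theorem integral_measureReal_le_eq {α : Type*} [MeasurableSpace α] [Countable α]
    [DiscreteMeasurableSpace α] (μ : Measure α) [IsProbabilityMeasure μ] {Y : Ω → ℝ} {F : ℝ → ℝ}
    (hY : Measurable Y) (hF : ∀ t, P.real {ω | Y ω ≤ t} = F t) (h : α → ℝ) :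
    ∫ ω, μ.real {a | Y ω ≤ h a} ∂P = ∫ a, F (h a) ∂μ := by
  have hS : MeasurableSet {q : Ω × α | Y q.1 ≤ h q.2} :=
    measurableSet_le (hY.comp measurable_fst) (Measurable.of_discrete.comp measurable_snd)
  have hint : Integrable (Function.uncurry fun (ω : Ω) (a : α) =>
      Set.indicator {q : Ω × α | Y q.1 ≤ h q.2} (1 : Ω × α → ℝ) (ω, a)) (P.prod μ) :=
    (integrable_const (1 : ℝ)).indicator hS
  have hswap := integral_integral_swap hint
  have e1 : ∀ ω, ∫ a, Set.indicator {q : Ω × α | Y q.1 ≤ h q.2} (1 : Ω × α → ℝ) (ω, a) ∂μ =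
      μ.real {a | Y ω ≤ h a} := fun ω => by
    rw [← integral_indicator_one (.of_discrete)]
    rfl
  have e2 : ∀ a, ∫ ω, Set.indicator {q : Ω × α | Y q.1 ≤ h q.2} (1 : Ω × α → ℝ) (ω, a) ∂P =
      F (h a) := fun a => by
    rw [← hF, ← integral_indicator_one (measurableSet_le hY measurable_const)]
    rfl
  simpa only [e1, e2] using hswap

theorem integral_tail {Y : Ω → ℝ} {F : ℝ → ℝ} (hY : Measurable Y)
    (hF : ∀ t, P.real {ω | Y ω ≤ t} = F t) (m x : ℝ) :
    ∫ ω, tail m x (Y ω) ∂P = poissonMean F x m :=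
  integral_measureReal_le_eq _ hY hF _

/-- The square of a probability is the probability for two independent copies, and both `N/m` and
`N'/m` are at least `t` exactly when their minimum is. -/
theorem integral_tail_sq {Y : Ω → ℝ} {F : ℝ → ℝ} (hY : Measurable Y)
    (hF : ∀ t, P.real {ω | Y ω ≤ t} = F t) {m : ℝ} (hm : 0 < m) (x : ℝ) :
    ∫ ω, tail m x (Y ω) ^ 2 ∂P = poissonMinMean F x m := by
  rw [poissonMinMean, ← integral_measureReal_le_eq _ hY hF]
  refine integral_congr_ae (Eventually.of_forall fun ω => ?_)
  simp only [tail]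
  rw [sq, ← measureReal_prod_prod]
  congr 1
  ext p
  simp [Nat.cast_min, le_div_iff₀ hm]

/-- The bias-variance decomposition of the mean-squared error. -/
theorem mse_eq {X : ℕ → Ω → ℝ} {F : ℝ → ℝ} (hX : ∀ i, Measurable (X i)) (hindep : iIndepFun X P)
    (hF : ∀ i t, P.real {ω | X i ω ≤ t} = F t) {x m : ℝ} (hx : 0 < x) (hm : 0 < m) {n : ℕ}
    (hn : 0 < n) :
    mse P X F x n m = (n : ℝ)⁻¹ * (poissonMinMean F x m - poissonMean F x m ^ 2) +
      (poissonMean F x m - F x) ^ 2 := by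
  have hn' : (n : ℝ) ≠ 0 := by positivity
  set Y : ℕ → Ω → ℝ := fun i ω => (1 / (n : ℝ)) * tail m x (X i ω) with hYdef
  have hmeas : ∀ i, Measurable fun ω => tail m x (X i ω) := fun i =>
    (measurable_tail m x).comp (hX i)
  have ht : ∀ i, MemLp (fun ω => tail m x (X i ω)) 2 P := fun i =>
    MemLp.of_bound (hmeas i).aestronglyMeasurable 1
      (Eventually.of_forall fun ω => abs_tail_le m x (X i ω))
  have hY : ∀ i, MemLp (Y i) 2 P := fun i => (ht i).const_mul _
  have hYind : iIndepFun Y P :=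
    hindep.comp (fun _ t => (1 / (n : ℝ)) * tail m x t) fun _ =>
      (measurable_tail m x).const_mul _
  have hvar : ∀ i, Var[Y i; P] =
      (1 / (n : ℝ)) ^ 2 * (poissonMinMean F x m - poissonMean F x m ^ 2) := fun i => by
    rw [hYdef]
    simp only
    rw [variance_const_mul, variance_eq_sub (ht i)]
    simp only [Pi.pow_apply]
    rw [integral_tail (hX i) (hF i), integral_tail_sq (hX i) (hF i) hm]
  set S : Ω → ℝ := ∑ i ∈ Finset.range n, Y i with hS
  have hSL : MemLp S 2 P := memLp_finsetSum' _ fun i _ => hY i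
  have hES : ∫ ω, S ω ∂P = poissonMean F x m := by
    simp only [hS, Finset.sum_apply]
    rw [integral_finsetSum _ fun i _ => (hY i).integrable one_le_two]
    simp only [hYdef, integral_const_mul, integral_tail (hX _) (hF _), Finset.sum_const,
      Finset.card_range, nsmul_eq_mul]
    field_simp
  have hVS : Var[S; P] = (n : ℝ)⁻¹ * (poissonMinMean F x m - poissonMean F x m ^ 2) := by
    rw [hS, IndepFun.variance_sum (fun i _ => hY i) fun i _ j _ hij => hYind.indepFun hij]
    simp only [hvar, Finset.sum_const, Finset.card_range, nsmul_eq_mul]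
    field_simp
  have h1 : mse P X F x n m = ∫ ω, (S ω - F x) ^ 2 ∂P := by
    simp only [mse, estimator_eq_sum_tail X hm hx, hS, Finset.sum_apply, hYdef]
  have h2 := variance_eq_sub (hSL.sub (memLp_const (F x)))
  have h3 : Var[S - fun _ => F x; P] = Var[S; P] :=
    variance_sub_const hSL.aestronglyMeasurable (F x)
  have h4 : ∫ ω, (S - (fun _ => F x) : Ω → ℝ) ω ∂P = poissonMean F x m - F x := by
    simp only [Pi.sub_apply]
    rw [integral_sub (hSL.integrable one_le_two) (integrable_const _), hES]
    simp
  rw [h3, hVS, h4] at h2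
  rw [h1, h2]
  simp only [Pi.pow_apply, Pi.sub_apply]
  ring

end MeanSquaredError

/-! ### Bounds, monotonicity and the sign of the density -/

section Density

variable {Ω : Type*} [MeasurableSpace Ω] {P : Measure Ω} [IsProbabilityMeasure P]

theorem mem_Icc_of_measureReal_eq {Y : Ω → ℝ} {F : ℝ → ℝ}
    (hF : ∀ t, P.real {ω | Y ω ≤ t} = F t) (t : ℝ) : F t ∈ Set.Icc (0 : ℝ) 1 := by
  rw [← hF]
  exact ⟨measureReal_nonneg, measureReal_le_one⟩

theorem monotone_of_measureReal_eq {Y : Ω → ℝ} {F : ℝ → ℝ}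
    (hF : ∀ t, P.real {ω | Y ω ≤ t} = F t) : Monotone F := fun s t hst => by
  rw [← hF, ← hF]
  exact measureReal_mono fun _ h => le_trans h hst

end Density

theorem nonneg_of_monotone_of_hasDerivWithinAt {F f : ℝ → ℝ} (hF : Monotone F) {x : ℝ} (hx : 0 < x)
    (hf : HasDerivWithinAt F (f x) (Set.Ici 0) x) : 0 ≤ f x := by
  rw [← (hf.hasDerivAt (Ici_mem_nhds hx)).deriv]
  exact hF.deriv_nonneg

/-! ### Stability of the minimum of a quartic -/

section QuarticMinimization

theorem quartic_sub_eq (u w : ℝ) :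
    u ^ 4 - 4 * w ^ 3 * u + 3 * w ^ 4 = (u - w) ^ 2 * ((u + w) ^ 2 + 2 * w ^ 2) := by
  ring

/-- Bounding the perturbation by the quartic itself makes its error relative, so large `r` does no
harm. -/
theorem quartic_bound (r : ℝ) : r ^ 4 + 4 * r ≤ 4 * (r ^ 4 - 4 * r + 3) + 24 := by
  nlinarith [sq_nonneg (r ^ 2 - 2), sq_nonneg (r - 2), sq_nonneg (r ^ 2 - 3), sq_nonneg (r - 1)]

theorem abs_perturbed_quartic_sub_le {r e₁ e₂ δ : ℝ} (hr : 0 ≤ r) (h₁ : |e₁ - 1| ≤ δ)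
    (h₂ : |e₂ - 1| ≤ δ) :
    |(r ^ 4 * e₁ - 4 * r * e₂ + 3) - (r ^ 4 - 4 * r + 3)| ≤
      δ * (4 * (r ^ 4 - 4 * r + 3) + 24) := by
  have hδ : 0 ≤ δ := (abs_nonneg _).trans h₁
  calc |(r ^ 4 * e₁ - 4 * r * e₂ + 3) - (r ^ 4 - 4 * r + 3)|
      = |r ^ 4 * (e₁ - 1) - 4 * r * (e₂ - 1)| := by ring_nf
    _ ≤ |r ^ 4 * (e₁ - 1)| + |4 * r * (e₂ - 1)| := abs_sub _ _
    _ = r ^ 4 * |e₁ - 1| + 4 * r * |e₂ - 1| := by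
        rw [abs_mul, abs_mul, abs_of_nonneg (by positivity : 0 ≤ r ^ 4),
          abs_of_nonneg (by positivity : 0 ≤ 4 * r)]
    _ ≤ r ^ 4 * δ + 4 * r * δ := by gcongr
    _ = δ * (r ^ 4 + 4 * r) := by ring
    _ ≤ _ := mul_le_mul_of_nonneg_left (quartic_bound r) hδ

theorem eventually_quartic_le {ι : Type*} {l : Filter ι} {r e₁ e₂ : ι → ℝ} (hr : ∀ᶠ i in l, 0 ≤ r i)
    (h₁ : Tendsto e₁ l (𝓝 1)) (h₂ : Tendsto e₂ l (𝓝 1)) {ε : ℝ} (hε : 0 < ε) :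
    ∀ᶠ i in l, (r i ^ 4 - 4 * r i + 3) / 2 ≤ r i ^ 4 * e₁ i - 4 * r i * e₂ i + 3 + ε := by
  -- In the bound `δ(4ψ + 24)`, with `ψ` the quartic, `1/8` gives `4δψ ≤ ψ/2` and `ε/24` gives `24δ
  -- ≤ ε`.
  set δ := min (1 / 8) (ε / 24) with hδ
  have hδ0 : 0 < δ := by positivity
  filter_upwards [hr, Metric.tendsto_nhds.1 h₁ δ hδ0, Metric.tendsto_nhds.1 h₂ δ hδ0] with i h h1 h2
  rw [Real.dist_eq] at h1 h2
  have hb := (abs_le.1 (abs_perturbed_quartic_sub_le h h1.le h2.le)).1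
  have hψ : 0 ≤ r i ^ 4 - 4 * r i + 3 := by
    have := quartic_sub_eq (r i) 1
    have h3 : 0 ≤ (r i - 1) ^ 2 * ((r i + 1) ^ 2 + 2 * 1 ^ 2) := by positivity
    linarith
  have l1 : δ * (r i ^ 4 - 4 * r i + 3) ≤ 1 / 8 * (r i ^ 4 - 4 * r i + 3) :=
    mul_le_mul_of_nonneg_right (min_le_left _ _) hψ
  have l2 : δ ≤ ε / 24 := min_le_right _ _
  linarith

theorem tendsto_perturbed_quartic_iff {ι : Type*} {l : Filter ι} {r e₁ e₂ : ι → ℝ}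
    (hr : ∀ᶠ i in l, 0 ≤ r i) (h₁ : Tendsto e₁ l (𝓝 1)) (h₂ : Tendsto e₂ l (𝓝 1)) :
    Tendsto (fun i => r i ^ 4 * e₁ i - 4 * r i * e₂ i) l (𝓝 (-3)) ↔ Tendsto r l (𝓝 1) := by
  refine ⟨fun h => ?_, fun h => ?_⟩
  · have hψ : Tendsto (fun i => (r i - 1) ^ 2) l (𝓝 0) := by
      rw [Metric.tendsto_nhds]
      intro ε hε
      filter_upwards [eventually_quartic_le hr h₁ h₂ (half_pos hε),
        Metric.tendsto_nhds.1 h (ε / 2) (half_pos hε), hr] with i hi hi' hri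
      rw [Real.dist_eq] at hi' ⊢
      rw [sub_zero, abs_of_nonneg (sq_nonneg _)]
      have h3 := (abs_lt.1 hi').2
      -- The second factor is at least `3`, so a small quartic forces `(r - 1)²` to be small.
      have h4 : r i ^ 4 - 4 * r i + 3 = (r i - 1) ^ 2 * ((r i + 1) ^ 2 + 2) := by ring
      nlinarith [sq_nonneg (r i - 1), mul_nonneg (sq_nonneg (r i - 1)) (by nlinarith : 0 ≤ (r i + 1) ^ 2 - 1)]
    have h5 : Tendsto (fun i => √((r i - 1) ^ 2)) l (𝓝 0) := by
      simpa [Function.comp_def] using (Real.continuous_sqrt.tendsto 0).comp hψ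
    simp only [Real.sqrt_sq_eq_abs] at h5
    rw [tendsto_iff_dist_tendsto_zero]
    simpa only [Real.dist_eq] using h5
  · convert! ((h.pow 4).mul h₁).sub ((h.const_mul 4).mul h₂) using 2
    norm_num

end QuarticMinimization

/-! ### Real exponents as integer powers of roots -/

section Powers

theorem natCast_eq_cbrt_pow (n : ℕ) : (n : ℝ) = ((n : ℝ) ^ ((1 : ℝ) / 3)) ^ 3 := by
  rw [← Real.rpow_natCast, ← Real.rpow_mul (by positivity)]
  norm_num

theorem rpow_two_thirds {y : ℝ} (hy : 0 ≤ y) : y ^ ((2 : ℝ) / 3) = (y ^ ((1 : ℝ) / 3)) ^ 2 := by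
  rw [← Real.rpow_natCast, ← Real.rpow_mul hy]
  norm_num

theorem rpow_neg_four_thirds {y : ℝ} (hy : 0 ≤ y) :
    y ^ (-(4 : ℝ) / 3) = ((y ^ ((1 : ℝ) / 3)) ^ 4)⁻¹ := by
  rw [← Real.rpow_natCast, ← Real.rpow_mul hy, ← Real.rpow_neg hy]
  norm_num

theorem rpow_neg_half {m : ℝ} (hm : 0 ≤ m) : m ^ (-(1 : ℝ) / 2) = (√m)⁻¹ := by
  rw [Real.sqrt_eq_rpow, ← Real.rpow_neg hm]
  norm_num

theorem rpow_neg_two' {m : ℝ} (hm : 0 ≤ m) : m ^ (-2 : ℝ) = (√m)⁻¹ ^ 4 := by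
  rw [Real.rpow_neg hm, Real.rpow_two, inv_pow, show (√m) ^ 4 = ((√m) ^ 2) ^ 2 by ring,
    Real.sq_sqrt hm]

end Powers

/-- `[4 b² / V]^{1/3}`, so that `m_opt(n) = (n^{1/3} q)²`. -/
noncomputable def optScale (f f' : ℝ → ℝ) (x : ℝ) : ℝ := (4 * b f' x ^ 2 / V f x) ^ ((1 : ℝ) / 3)

/-! ### The optimal parameter and the leading part of the risk -/

section OptimalParameter

variable {F f f' : ℝ → ℝ} {x : ℝ}

theorem optScale_pos (hV : 0 < V f x) (hb : b f' x ≠ 0) : 0 < optScale f f' x := by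
  unfold optScale
  positivity

theorem optScale_pow_three (hV : 0 < V f x) : optScale f f' x ^ 3 * V f x = 4 * b f' x ^ 2 := by
  rw [optScale, ← Real.rpow_natCast, ← Real.rpow_mul (by positivity)]
  norm_num
  field_simp

theorem mOpt_eq_sq (hV : 0 < V f x) (n : ℕ) :
    mOpt f f' x n = ((n : ℝ) ^ ((1 : ℝ) / 3) * optScale f f' x) ^ 2 := by
  rw [mOpt, optScale, rpow_two_thirds (by positivity), rpow_two_thirds (by positivity), mul_pow]

theorem sqrt_mOpt (hV : 0 < V f x) (n : ℕ) :
    √(mOpt f f' x n) = (n : ℝ) ^ ((1 : ℝ) / 3) * optScale f f' x := by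
  rw [mOpt_eq_sq hV, Real.sqrt_sq]
  unfold optScale
  positivity

theorem mOpt_pos (hV : 0 < V f x) (hb : b f' x ≠ 0) {n : ℕ} (hn : 0 < n) : 0 < mOpt f f' x n := by
  have := optScale_pos hV hb
  rw [mOpt_eq_sq hV]
  positivity

theorem tendsto_cbrt_atTop : Tendsto (fun n : ℕ => (n : ℝ) ^ ((1 : ℝ) / 3)) atTop atTop :=
  (tendsto_rpow_atTop (by norm_num)).comp tendsto_natCast_atTop_atTop

theorem tendsto_mOpt (hV : 0 < V f x) (hb : b f' x ≠ 0) : Tendsto (mOpt f f' x) atTop atTop := by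
  rw [funext (mOpt_eq_sq hV)]
  exact (tendsto_pow_atTop two_ne_zero).comp
    (tendsto_cbrt_atTop.atTop_mul_const (optScale_pos hV hb))

theorem leadingMse_mOpt_lt (hV : 0 < V f x) (hb : b f' x ≠ 0) {n : ℕ} (hn : 0 < n) {m : ℝ}
    (hm : 0 < m) (hne : m ≠ mOpt f f' x n) :
    leadingMse F f f' x n (mOpt f f' x n) < leadingMse F f f' x n m := by
  have hq := optScale_pos hV hb
  have hq3 := optScale_pow_three (f' := f') hV
  have hm₀ := mOpt_pos hV hb hn
  have hν : 0 < (n : ℝ) ^ ((1 : ℝ) / 3) := by positivity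
  have hnν := natCast_eq_cbrt_pow n
  set ν := (n : ℝ) ^ ((1 : ℝ) / 3)
  set q := optScale f f' x
  have hs : (√m)⁻¹ ≠ (ν * q)⁻¹ := fun h => hne <| by
    rw [← Real.sq_sqrt hm.le, inv_injective h, mOpt_eq_sq hV]
  -- With `u = 1/√m` and `w = 1/(νq)`, the leading part becomes `σ²/n + b²(u⁴ - 4w³u)`, minimal only
  -- at `u = w`.
  have hc : (n : ℝ)⁻¹ * V f x = 4 * b f' x ^ 2 * (ν * q)⁻¹ ^ 3 := by
    rw [hnν, ← hq3]
    field_simp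
  have hpos : 0 < b f' x ^ 2 * (((√m)⁻¹ - (ν * q)⁻¹) ^ 2 *
      (((√m)⁻¹ + (ν * q)⁻¹) ^ 2 + 2 * (ν * q)⁻¹ ^ 2)) := by
    have : (√m)⁻¹ - (ν * q)⁻¹ ≠ 0 := sub_ne_zero.2 hs
    positivity
  rw [← quartic_sub_eq] at hpos
  rw [leadingMse, leadingMse, rpow_neg_half hm.le, rpow_neg_half hm₀.le, rpow_neg_two' hm.le,
    rpow_neg_two' hm₀.le, sqrt_mOpt hV, mul_assoc, mul_assoc, hc]
  linarith

/-- The normalized error `n^{4/3} (R - σ²/n)` as a perturbed quartic in the ratio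
`(m_opt / m)^{1/2}`. -/
theorem normalized_risk_eq (hV : 0 < V f x) (hb : b f' x ≠ 0) {n : ℕ} (hn : 0 < n) {m : ℝ}
    (hm : 0 < m) (s v β : ℝ) :
    (n : ℝ)⁻¹ * v + β ^ 2 = (n : ℝ)⁻¹ * s + b f' x ^ 2 / optScale f f' x ^ 4 *
      ((√(mOpt f f' x n) / √m) ^ 4 * ((m * β) ^ 2 / b f' x ^ 2) -
        4 * (√(mOpt f f' x n) / √m) * (√m * (v - s) / (-V f x))) * (n : ℝ) ^ (-(4 : ℝ) / 3) := by
  have hq := optScale_pos hV hb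
  have hq3 := optScale_pow_three (f' := f') hV
  have hν : 0 < (n : ℝ) ^ ((1 : ℝ) / 3) := by positivity
  have hnν := natCast_eq_cbrt_pow n
  rw [rpow_neg_four_thirds (by positivity), sqrt_mOpt hV]
  set ν := (n : ℝ) ^ ((1 : ℝ) / 3)
  set q := optScale f f' x
  have hs : 0 < √m := Real.sqrt_pos.2 hm
  obtain ⟨w, hw, rfl⟩ : ∃ w, 0 < w ∧ m = w ^ 2 := ⟨√m, hs, (Real.sq_sqrt hm.le).symm⟩
  rw [Real.sqrt_sq hw.le, hnν]
  have hb2 : b f' x ^ 2 = q ^ 3 * V f x / 4 := by linarith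
  rw [hb2]
  field_simp
  ring

end OptimalParameter

/-! ### From the bias and variance limits to asymptotic optimality -/

section AsymptoticOptimality

variable {f f' : ℝ → ℝ} {x s : ℝ} {v β : ℝ → ℝ} {R : ℕ → ℝ → ℝ}

/-- The normalized error `n^{4/3} (R n m - s / n)`, up to the factor `b² / q⁴`. -/
noncomputable def normalizedRisk (f f' v β : ℝ → ℝ) (x s : ℝ) (n : ℕ) (m : ℝ) : ℝ :=
  (√(mOpt f f' x n) / √m) ^ 4 * ((m * β m) ^ 2 / b f' x ^ 2) -
    4 * (√(mOpt f f' x n) / √m) * (√m * (v m - s) / (-V f x))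

theorem risk_eq_normalizedRisk (hV : 0 < V f x) (hb : b f' x ≠ 0)
    (hR : ∀ n m, 0 < n → 0 < m → R n m = (n : ℝ)⁻¹ * v m + β m ^ 2) {n : ℕ} {m : ℝ} (hn : 0 < n)
    (hm : 0 < m) :
    R n m = (n : ℝ)⁻¹ * s + b f' x ^ 2 / optScale f f' x ^ 4 *
      normalizedRisk f f' v β x s n m * (n : ℝ) ^ (-(4 : ℝ) / 3) := by
  rw [hR n m hn hm, normalized_risk_eq hV hb hn hm s]
  rfl

theorem tendsto_sq_ratio (hb : b f' x ≠ 0)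
    (hβ : Tendsto (fun m => m * β m) atTop (𝓝 (b f' x))) {m : ℕ → ℝ} (hm : Tendsto m atTop atTop) :
    Tendsto (fun n => (m n * β (m n)) ^ 2 / b f' x ^ 2) atTop (𝓝 1) := by
  have := ((hβ.comp hm).pow 2).div_const (b f' x ^ 2)
  rwa [div_self (pow_ne_zero 2 hb)] at this

theorem tendsto_variance_ratio (hV : 0 < V f x)
    (hv : Tendsto (fun m => √m * (v m - s)) atTop (𝓝 (-V f x))) {m : ℕ → ℝ}
    (hm : Tendsto m atTop atTop) :
    Tendsto (fun n => √(m n) * (v (m n) - s) / (-V f x)) atTop (𝓝 1) := by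
  have := (hv.comp hm).div_const (-V f x)
  rwa [div_self (neg_ne_zero.2 hV.ne')] at this

/-- The value `-3` is approached only if `r = √(m_opt/m) → 1`, and `m/m_opt = r⁻²` eventually. -/
theorem tendsto_normalizedRisk_iff (hV : 0 < V f x) (hb : b f' x ≠ 0)
    (hv : Tendsto (fun m => √m * (v m - s)) atTop (𝓝 (-V f x)))
    (hβ : Tendsto (fun m => m * β m) atTop (𝓝 (b f' x))) {m : ℕ → ℝ} (hm : Tendsto m atTop atTop) :
    Tendsto (fun n => normalizedRisk f f' v β x s n (m n)) atTop (𝓝 (-3)) ↔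
      m ~[atTop] mOpt f f' x := by
  have h := tendsto_perturbed_quartic_iff (l := atTop)
    (r := fun n => √(mOpt f f' x n) / √(m n)) (Eventually.of_forall fun n => by positivity)
    (tendsto_sq_ratio hb hβ hm) (tendsto_variance_ratio hV hv hm)
  refine Iff.trans h ?_
  have hpos : ∀ᶠ n : ℕ in atTop, 0 < mOpt f f' x n ∧ 0 < m n :=
    ((tendsto_mOpt hV hb).eventually_gt_atTop 0).and (hm.eventually_gt_atTop 0)
  rw [isEquivalent_iff_tendsto_one (hpos.mono fun n hn => hn.1.ne')]
  constructor
  · intro h1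
    have h2 := (h1.pow 2).inv₀ (by norm_num)
    rw [one_pow, inv_one] at h2
    refine h2.congr' ?_
    filter_upwards [hpos] with n hn
    rw [div_pow, Real.sq_sqrt hn.1.le, Real.sq_sqrt hn.2.le, inv_div]
    rfl
  · intro h1
    have h2 := (Real.continuous_sqrt.tendsto _).comp (h1.inv₀ (by norm_num))
    rw [inv_one, Real.sqrt_one] at h2
    refine h2.congr' ?_
    filter_upwards [hpos] with n hn
    simp only [Function.comp_apply, Pi.div_apply, inv_div]
    rw [Real.sqrt_div hn.1.le]

theorem isLittleO_mul_rate_iff (T : ℕ → ℝ) :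
    (fun n => T n * (n : ℝ) ^ (-(4 : ℝ) / 3)) =o[atTop] (fun n : ℕ => (n : ℝ) ^ (-(4 : ℝ) / 3)) ↔
      Tendsto T atTop (𝓝 0) := by
  have hpos : ∀ᶠ n : ℕ in atTop, (n : ℝ) ^ (-(4 : ℝ) / 3) ≠ 0 := by
    filter_upwards [eventually_gt_atTop 0] with n hn
    positivity
  rw [isLittleO_iff_tendsto' (hpos.mono fun n h0 h => absurd h h0)]
  refine tendsto_congr' ?_
  filter_upwards [hpos] with n hn
  rw [mul_div_cancel_right₀ _ hn]

theorem isAsymptoticallyOptimal_mOpt (hV : 0 < V f x) (hb : b f' x ≠ 0)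
    (hR : ∀ n m, 0 < n → 0 < m → R n m = (n : ℝ)⁻¹ * v m + β m ^ 2)
    (hv : Tendsto (fun m => √m * (v m - s)) atTop (𝓝 (-V f x)))
    (hβ : Tendsto (fun m => m * β m) atTop (𝓝 (b f' x))) :
    IsAsymptoticallyOptimal R (fun n => (n : ℝ) ^ (-(4 : ℝ) / 3)) (mOpt f f' x) := by
  have hopt := tendsto_mOpt hV hb
  have hq := optScale_pos hV hb
  have hT₀ := (tendsto_normalizedRisk_iff hV hb hv hβ hopt).2 IsEquivalent.refl
  set κ := b f' x ^ 2 / optScale f f' x ^ 4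
  have hκ : 0 < κ := by positivity
  refine ⟨hopt, fun m hm => ?_⟩
  have hdiff : ∀ᶠ n : ℕ in atTop, R n (m n) - R n (mOpt f f' x n) =
      κ * (normalizedRisk f f' v β x s n (m n) - normalizedRisk f f' v β x s n (mOpt f f' x n)) *
        (n : ℝ) ^ (-(4 : ℝ) / 3) := by
    filter_upwards [hm.eventually_gt_atTop 0, eventually_gt_atTop 0] with n hmn hn
    rw [risk_eq_normalizedRisk (s := s) hV hb hR hn hmn,
      risk_eq_normalizedRisk (s := s) hV hb hR hn (mOpt_pos hV hb hn)]
    ring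
  refine ⟨fun ε hε => ?_, ?_⟩
  -- The tolerance `ε` is split evenly: half for the lower bound along `m`, half for convergence to
  -- `-3` along `m_opt`; `κ` undoes the normalization.
  · have hlow := eventually_quartic_le (l := atTop)
      (r := fun n => √(mOpt f f' x n) / √(m n)) (Eventually.of_forall fun n => by positivity)
      (tendsto_sq_ratio hb hβ hm) (tendsto_variance_ratio hV hv hm)
      (ε := ε / (2 * κ)) (by positivity)
    filter_upwards [hlow, hdiff, hT₀.eventually_lt_const (u := -3 + ε / (2 * κ))
      (lt_add_of_pos_right _ (by positivity))] with n h1 h2 h3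
    have h4 : 0 ≤ (√(mOpt f f' x n) / √(m n)) ^ 4 - 4 * (√(mOpt f f' x n) / √(m n)) + 3 := by
      have h := quartic_sub_eq (√(mOpt f f' x n) / √(m n)) 1
      have h' : 0 ≤ (√(mOpt f f' x n) / √(m n) - 1) ^ 2 *
        ((√(mOpt f f' x n) / √(m n) + 1) ^ 2 + 2 * 1 ^ 2) := by positivity
      linarith
    have h5 : -3 - ε / (2 * κ) ≤ normalizedRisk f f' v β x s n (m n) := by
      rw [normalizedRisk]
      linarith
    have h6 : -ε ≤ κ * (normalizedRisk f f' v β x s n (m n) -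
        normalizedRisk f f' v β x s n (mOpt f f' x n)) := by
      have : -ε = κ * (-(ε / (2 * κ)) - ε / (2 * κ)) := by field_simp; ring
      rw [this]
      exact mul_le_mul_of_nonneg_left (by linarith) hκ.le
    have h7 := mul_le_mul_of_nonneg_right h6
      (by positivity : 0 ≤ (n : ℝ) ^ (-(4 : ℝ) / 3))
    rw [← h2] at h7
    linarith
  · rw [← tendsto_normalizedRisk_iff (s := s) hV hb hv hβ hm, isLittleO_congr hdiff .rfl,
      isLittleO_mul_rate_iff]
    constructor
    · intro h
      have h1 := (h.const_mul κ⁻¹).add hT₀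
      rw [mul_zero, zero_add] at h1
      refine h1.congr fun n => ?_
      rw [inv_mul_cancel_left₀ hκ.ne', sub_add_cancel]
    · intro h
      simpa using (h.sub hT₀).const_mul κ

/-- From `q³ V = 4b²` both sides equal `V/q`. This rewrites the limit constant `-3b²/q⁴` in the
stated form. -/
theorem optScale_risk_const (hV : 0 < V f x) (hb : b f' x ≠ 0) :
    4 * (b f' x ^ 2 / optScale f f' x ^ 4) =
      (V f x ^ 4 / (4 * b f' x ^ 2)) ^ ((1 : ℝ) / 3) := by
  have hq := optScale_pos hV hb
  have hq3 := optScale_pow_three (f' := f') hV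
  have h1 : 4 * (b f' x ^ 2 / optScale f f' x ^ 4) = V f x / optScale f f' x := by
    rw [← mul_div_assoc, ← hq3]
    field_simp
  have h2 : V f x ^ 4 / (4 * b f' x ^ 2) = (V f x / optScale f f' x) ^ 3 := by
    rw [← hq3]
    field_simp
  rw [h1, h2, ← Real.rpow_natCast, ← Real.rpow_mul (by positivity)]
  norm_num

theorem risk_mOpt_expansion (hV : 0 < V f x) (hb : b f' x ≠ 0)
    (hR : ∀ n m, 0 < n → 0 < m → R n m = (n : ℝ)⁻¹ * v m + β m ^ 2)
    (hv : Tendsto (fun m => √m * (v m - s)) atTop (𝓝 (-V f x)))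
    (hβ : Tendsto (fun m => m * β m) atTop (𝓝 (b f' x))) :
    (fun n : ℕ => R n (mOpt f f' x n) - ((n : ℝ)⁻¹ * s - 3 / 4 * (n : ℝ) ^ (-(4 : ℝ) / 3) *
      (V f x ^ 4 / (4 * b f' x ^ 2)) ^ ((1 : ℝ) / 3)))
      =o[atTop] (fun n : ℕ => (n : ℝ) ^ (-(4 : ℝ) / 3)) := by
  have hT₀ := (tendsto_normalizedRisk_iff hV hb hv hβ (tendsto_mOpt hV hb)).2 IsEquivalent.refl
  have h := (hT₀.add_const 3).const_mul (b f' x ^ 2 / optScale f f' x ^ 4)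
  rw [neg_add_cancel, mul_zero] at h
  refine ((isLittleO_mul_rate_iff _).2 h).congr' ?_ .rfl
  filter_upwards [eventually_gt_atTop 0] with n hn
  rw [risk_eq_normalizedRisk (s := s) hV hb hR hn (mOpt_pos hV hb hn), ← optScale_risk_const hV hb]
  ring

end AsymptoticOptimality

end Szasz

theorem mainTheorem7 {Ω : Type*} [MeasurableSpace Ω] (P : Measure Ω) [IsProbabilityMeasure P]
    (X : ℕ → Ω → ℝ) (F f f' : ℝ → ℝ)
    -- an i.i.d. sequence of nonnegative random variables with distribution function `F`
    (hX : ∀ i, Measurable (X i)) (hindep : iIndepFun X P)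
    (hF : ∀ i t, P.real {ω | X i ω ≤ t} = F t)
    (hnonneg : ∀ i, ∀ᵐ ω ∂P, 0 ≤ X i ω)
    -- `F` is continuous, its first two derivatives are continuous and bounded on `[0, ∞)`
    (hFcont : Continuous F)
    (hf : ∀ y ∈ Set.Ici (0 : ℝ), HasDerivWithinAt F (f y) (Set.Ici 0) y)
    (hf' : ∀ y ∈ Set.Ici (0 : ℝ), HasDerivWithinAt f (f' y) (Set.Ici 0) y)
    (hfcont : ContinuousOn f (Set.Ici 0)) (hf'cont : ContinuousOn f' (Set.Ici 0))
    (hfbdd : ∃ C, ∀ y ∈ Set.Ici (0 : ℝ), |f y| ≤ C)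
    (hf'bdd : ∃ C, ∀ y ∈ Set.Ici (0 : ℝ), |f' y| ≤ C)
    (x : ℝ) (hx : 0 < x) (hfx : f x ≠ 0) (hf'x : f' x ≠ 0) :
    (∀ n : ℕ, 0 < n → 0 < Szasz.mOpt f f' x n ∧
      ∀ m : ℝ, 0 < m → m ≠ Szasz.mOpt f f' x n →
        Szasz.leadingMse F f f' x n (Szasz.mOpt f f' x n) < Szasz.leadingMse F f f' x n m) ∧
    Szasz.IsAsymptoticallyOptimal (Szasz.mse P X F x) (fun n => (n : ℝ) ^ (-(4 : ℝ) / 3))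
      (Szasz.mOpt f f' x) ∧
    (fun n : ℕ => Szasz.mse P X F x n (Szasz.mOpt f f' x n) -
        ((n : ℝ)⁻¹ * Szasz.sigmaSq F x -
          3 / 4 * (n : ℝ) ^ (-(4 : ℝ) / 3) *
            (Szasz.V f x ^ 4 / (4 * Szasz.b f' x ^ 2)) ^ ((1 : ℝ) / 3)))
      =o[atTop] (fun n : ℕ => (n : ℝ) ^ (-(4 : ℝ) / 3)) := by
  have hF01 := Szasz.mem_Icc_of_measureReal_eq (hF 0)
  -- Monotonicity of `F` gives `f x ≥ 0`; together with `f x ≠ 0` this yields `V > 0`, on which the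
  -- minimization rests.
  have hfpos : 0 < f x := lt_of_le_of_ne (Szasz.nonneg_of_monotone_of_hasDerivWithinAt
    (Szasz.monotone_of_measureReal_eq (hF 0)) hx (hf x hx.le)) hfx.symm
  have hV : 0 < Szasz.V f x := by
    unfold Szasz.V
    have := Real.pi_pos
    positivity
  have hb : Szasz.b f' x ≠ 0 := by
    unfold Szasz.b
    positivity
  have hR := fun (n : ℕ) (m : ℝ) (hn : 0 < n) (hm : 0 < m) =>
    Szasz.mse_eq hX hindep hF hx hm hn
  have hv := Szasz.tendsto_sqrt_mul_variance_sub hx hF01 hf hf' hf'bdd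
  have hβ := Szasz.tendsto_mul_poissonMean_sub hx hF01 hf hf' hf'bdd
  exact ⟨fun n hn => ⟨Szasz.mOpt_pos hV hb hn,
      fun m hm hne => Szasz.leadingMse_mOpt_lt hV hb hn hm hne⟩,
    Szasz.isAsymptoticallyOptimal_mOpt hV hb hR hv hβ,
    Szasz.risk_mOpt_expansion hV hb hR hv hβ⟩
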